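/- Let $S\subset\mathbb Z$ be nonempty and let $\mathcal B$ be the (homothecy invariant, i.e. invariant under translations and positive dilations) collection of all boxes in $\mathbb R^3$ with sides parallel to the coordinate axes and with side lengths $s,\ 2^j s,\ t$ along the first, second and third axis, respectively, where $s,t>0$ are arbitrary and $j\in S$. Let $$M_{\mathcal B}f(x)=\sup_{x\in R\in\mathcal B}\frac1{|R|}\int_R|f|$$ be the associated maximal operator. 1. If $S$ is finite, there is a constant $C<\infty$ such that for all measurable $f:\mathbb R^3\to\mathbb R$ and all $\alpha>0$ $$\left|\left\{x\in\mathbb R^3: M_{\mathcal B}f(x)>\alpha\right\}\right|\le C\int_{\mathbb R^3}\frac{|f|}{\alpha}\left(1+\log^+\frac{|f|}{\alpha}\right).$$ On the other hand, if $\phi:[0,\infty)\to[0,\infty)$ is a convex increasing function with $\phi(0)=0$ and $\lim_{x\to\infty}\frac{\phi(x)}{x\log(1+x)}=0$, then there is no constant $C<\infty$ such that for all measurable $f$ and all $\alpha>0$ $$\left|\left\{x\in\mathbb R^3: M_{\mathcal B}f(x)>\alpha\right\}\right|\le C\int_{\mathbb R^3}\phi\left(\frac{|f|}{\alpha}\right).$$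 2. If $S$ is infinite, there is a constant $C<\infty$ such that for all measurable $f:\mathbb R^3\to\mathbb R$ and all $\alpha>0$ $$\left|\left\{x\in\mathbb R^3: M_{\mathcal B}f(x)>\alpha\right\}\right|\le C\int_{\mathbb R^3}\frac{|f|}{\alpha}\left(1+\log^+\frac{|f|}{\alpha}\right)^2.$$ On the other hand, if $\phi:[0,\infty)\to[0,\infty)$ is a convex increasing function with $\phi(0)=0$ and $\lim_{x\to\infty}\frac{\phi(x)}{x(\log(1+x))^2}=0$, then there is no constant $C<\infty$ such that for all measurable $f$ and all $\alpha>0$ $$\left|\left\{x\in\mathbb R^3: M_{\mathcal B}f(x)>\alpha\right\}\right|\le C\int_{\mathbb R^3}\phi\left(\frac{|f|}{\alpha}\right).$$ -/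

import Mathlib

open MeasureTheory

noncomputable section

/-- The basis attached to `S ⊆ ℤ`: all (closed, nondegenerate) boxes in `ℝ³` with sides parallel to
the coordinate axes, whose side lengths along the first, second and third axis are
`s`, `2 ^ j * s`, `t`, with arbitrary position, arbitrary `s, t > 0` and `j ∈ S`. -/
def zygmundBasis (S : Set ℤ) : Set (Set (Fin 3 → ℝ)) :=
  {R | ∃ j ∈ S, ∃ s t : ℝ, 0 < s ∧ 0 < t ∧
    ∃ a : Fin 3 → ℝ, R = Set.Icc a (a + ![s, (2 : ℝ) ^ j * s, t])}

/-- A collection of sets in `ℝ³` is homothecy invariant if it is closed under translations and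
positive dilations. -/
def HomothecyInvariant (B : Set (Set (Fin 3 → ℝ))) : Prop :=
  ∀ R ∈ B, ∀ (c : ℝ) (b : Fin 3 → ℝ), 0 < c → (fun x => c • x + b) '' R ∈ B

/-- The uncentered maximal operator `M_B f (x) = sup_{x ∈ R ∈ B} |R|⁻¹ ∫_R |f|`, with values
in `[0, ∞]`. -/
def maximalOperator (B : Set (Set (Fin 3 → ℝ))) (f : (Fin 3 → ℝ) → ℝ) (x : Fin 3 → ℝ) : ENNReal :=
  ⨆ R ∈ B, ⨆ _ : x ∈ R, (volume R)⁻¹ * ∫⁻ y in R, ENNReal.ofReal |f y|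

/-- The weak type estimate `|{M_B f > α}| ≤ C ∫ φ(|f| / α)` for all (Lebesgue) measurable `f` and
all `α > 0`, with a finite constant `C` independent of `f` and `α`. The right side may be `∞`. -/
def WeakTypeEstimate (B : Set (Set (Fin 3 → ℝ))) (φ : ℝ → ℝ) : Prop :=
  ∃ C : ℝ, 0 < C ∧ ∀ f : (Fin 3 → ℝ) → ℝ, AEMeasurable f volume → ∀ α : ℝ, 0 < α →
    volume {x | ENNReal.ofReal α < maximalOperator B f x} ≤
      ENNReal.ofReal C * ∫⁻ x, ENNReal.ofReal (φ (|f x| / α))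

/-- `φ : [0, ∞) → [0, ∞)` is convex and increasing with `φ(0) = 0`; only the values on `[0, ∞)`
are constrained. -/
structure IsConvexIncreasing (φ : ℝ → ℝ) : Prop where
  nonneg : ∀ x, 0 ≤ x → 0 ≤ φ x
  map_zero : φ 0 = 0
  convexOn : ConvexOn ℝ (Set.Ici 0) φ
  monotoneOn : MonotoneOn φ (Set.Ici 0)

theorem zygmundBasis_homothecyInvariant (S : Set ℤ) : HomothecyInvariant (zygmundBasis S) := by
  rintro R ⟨j, hj, s, t, hs, ht, a, rfl⟩ c b hc
  refine ⟨j, hj, c * s, c * t, by positivity, by positivity, c • a + b, ?_⟩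
  have hv : (![c * s, (2 : ℝ) ^ j * (c * s), c * t] : Fin 3 → ℝ)
      = c • ![s, (2 : ℝ) ^ j * s, t] := by
    ext i
    fin_cases i
    · simp
    · simp
      ring
    · simp
  rw [hv]
  generalize ![s, (2 : ℝ) ^ j * s, t] = v
  ext y
  simp only [Set.mem_image, Set.mem_Icc, Pi.le_def, Pi.add_apply, Pi.smul_apply, smul_eq_mul]
  constructor
  · rintro ⟨x, ⟨h1, h2⟩, rfl⟩
    refine ⟨fun i => ?_, fun i => ?_⟩
    · have := mul_le_mul_of_nonneg_left (h1 i) hc.le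
      simp only [Pi.add_apply, Pi.smul_apply, smul_eq_mul]
      linarith
    · have := mul_le_mul_of_nonneg_left (h2 i) hc.le
      simp only [Pi.add_apply, Pi.smul_apply, smul_eq_mul]
      linarith
  · rintro ⟨h1, h2⟩
    refine ⟨fun i => (y i - b i) / c, ⟨fun i => ?_, fun i => ?_⟩, ?_⟩
    · rw [le_div_iff₀ hc]
      linarith [h1 i]
    · rw [div_le_iff₀ hc]
      linarith [h2 i]
    · ext i
      simp only [Pi.add_apply, Pi.smul_apply, smul_eq_mul]
      field_simp
      ring

end

/-! Upper bounds. For a family with the Vitali engulfing property the maximal operator is of weak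
type (1,1). Moreover, the part of `f` below half the level can be discarded, so that the bound at
level 1 only sees `{f > 1/2}`. This truncated form can be iterated. On products `B × D` the maximal
operator is dominated by that of `B` in the first variable applied to that of `D` in the second, and
adding the truncated bounds over the levels `2 ^ n` costs one logarithm (`BasisWeakType.prod`). For
one ratio `2 ^ j` the boxes are products of rectangles of fixed shape, a one-parameter family, with
intervals: one logarithm. Finitely many ratios are a finite union. For arbitrary `S` every box is a
product of three intervals: two logarithms. Rational families, comparable in volume, supply the
countability that measurability needs.

Lower bounds. By `not_weakTypeEstimate_of_lowerBound` it suffices to find, for each `n`, a set `Q`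
such that `1_Q` has maximal function above `1 / (2 * 4 ^ n)` on a set of measure at least `c * n ^ k
* 4 ^ n * |Q|`. For `k = 1`, `n` boxes of equal volume `4 ^ n * |Q|` and different eccentricities
contain a box `Q`, and their outer halves are disjoint. For `k = 2`, choose a lacunary sequence `j
i` in `S` and let `Q` be cut out by vanishing binary digits of `x` at the places `j i` and of `y` at
the places `-j i`. A box of ratio `2 ^ j a` with sides about `2 ^ (j b - j a)` and `2 ^ j b` leaves
undetermined exactly the digits `i ≥ a` in `x` and `i ≤ b` in `y`. Hence the scale `s` provides a
second free index `b`, and `n ^ 2` pairs `(a, b)` give disjoint sets of equal measure. If `S` is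
infinite but bounded above, exchanging the first two axes replaces `S` by `-S`. -/

noncomputable section

open Set
open scoped ENNReal

/-! ### Dyadic Young functions -/

/-- A dyadic model of the Young function `u (log⁺ u) ^ k`: the sum of `2 ^ n (n + 1) ^ k` over all
`n` with `2 ^ n < u`. -/
def dyadicOrlicz (k : ℕ) (u : ℝ≥0∞) : ℝ≥0∞ :=
  ∑' n : ℕ, (Ioi ((2 : ℝ≥0∞) ^ n)).indicator (fun _ => 2 ^ n * ((n : ℝ≥0∞) + 1) ^ k) u

theorem measurable_dyadicOrlicz (k : ℕ) : Measurable (dyadicOrlicz k) :=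
  Measurable.tsum fun _ => measurable_const.indicator measurableSet_Ioi

theorem dyadicOrlicz_mono (k : ℕ) : Monotone (dyadicOrlicz k) := by
  intro u v huv
  refine ENNReal.tsum_le_tsum fun n => ?_
  by_cases h : u ∈ Ioi ((2 : ℝ≥0∞) ^ n)
  · have h' : v ∈ Ioi ((2 : ℝ≥0∞) ^ n) := lt_of_lt_of_le h huv
    rw [indicator_of_mem h, indicator_of_mem h']
  · rw [indicator_of_notMem h]
    exact zero_le

theorem le_dyadicOrlicz_of_lt {k n : ℕ} {u : ℝ≥0∞} (h : 2 ^ n < u) : 2 ^ n ≤ dyadicOrlicz k u := by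
  refine le_trans ?_ (ENNReal.le_tsum n)
  rw [indicator_of_mem (mem_Ioi.2 h)]
  refine le_mul_of_one_le_right zero_le (one_le_pow₀ ?_)
  exact le_add_self

theorem le_two_mul_dyadicOrlicz {k : ℕ} {u : ℝ≥0∞} (hu : 1 < u) : u ≤ 2 * dyadicOrlicz k u := by
  by_cases h : ∀ n : ℕ, (2 : ℝ≥0∞) ^ n < u
  · have : dyadicOrlicz k u = ∞ := by
      refine ENNReal.eq_top_of_forall_nnreal_le fun r => ?_
      obtain ⟨n, hn⟩ := pow_unbounded_of_one_lt r one_lt_two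
      refine le_trans ?_ (le_dyadicOrlicz_of_lt (h n))
      exact_mod_cast hn.le
    simp [this]
  · push Not at h
    classical
    have hfind := Nat.find_spec h
    obtain ⟨m, hm⟩ : ∃ m, Nat.find h = m + 1 := by
      refine Nat.exists_eq_succ_of_ne_zero fun h0 => ?_
      rw [h0, pow_zero] at hfind
      exact absurd hu (not_lt.2 hfind)
    have hlt : 2 ^ m < u := not_le.1 (Nat.find_min h (m := m) (by omega))
    rw [hm, pow_succ'] at hfind
    exact hfind.trans (by gcongr; exact le_dyadicOrlicz_of_lt hlt)

/-- The source of the extra logarithm: on the diagonal `n + m = N` there are `N + 1` pairs, each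
contributing at most `2 ^ N * (N + 1) ^ k`. -/
theorem tsum_mul_dyadicOrlicz_zero_le (k : ℕ) (u : ℝ≥0∞) :
    ∑' n : ℕ, 2 ^ n * ((n : ℝ≥0∞) + 1) ^ k * dyadicOrlicz 0 (u / 2 ^ n) ≤
      dyadicOrlicz (k + 1) u := by
  have h2 (n m : ℕ) : u / 2 ^ n ∈ Ioi ((2 : ℝ≥0∞) ^ m) ↔ u ∈ Ioi ((2 : ℝ≥0∞) ^ (n + m)) := by
    rw [mem_Ioi, mem_Ioi, ENNReal.lt_div_iff_mul_lt (by simp) (by simp), pow_add, mul_comm]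
  have h1 (n : ℕ) : 2 ^ n * ((n : ℝ≥0∞) + 1) ^ k * dyadicOrlicz 0 (u / 2 ^ n) =
      ∑' m : ℕ, (Ioi ((2 : ℝ≥0∞) ^ (n + m))).indicator
        (fun _ => 2 ^ (n + m) * ((n : ℝ≥0∞) + 1) ^ k) u := by
    rw [dyadicOrlicz, ← ENNReal.tsum_mul_left]
    refine tsum_congr fun m => ?_
    by_cases h : u ∈ Ioi ((2 : ℝ≥0∞) ^ (n + m))
    · rw [indicator_of_mem h, indicator_of_mem ((h2 n m).2 h), pow_add]
      ring
    · rw [indicator_of_notMem h, indicator_of_notMem (fun h' => h ((h2 n m).1 h')), mul_zero]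
  simp_rw [h1]
  rw [← ENNReal.tsum_prod' (f := fun p : ℕ × ℕ => (Ioi ((2 : ℝ≥0∞) ^ (p.1 + p.2))).indicator
        (fun _ => 2 ^ (p.1 + p.2) * ((p.1 : ℝ≥0∞) + 1) ^ k) u),
    ← Finset.HasAntidiagonal.sigmaAntidiagonalEquivProd.tsum_eq, ENNReal.tsum_sigma', dyadicOrlicz]
  refine ENNReal.tsum_le_tsum fun N => ?_
  rw [tsum_fintype]
  by_cases h : u ∈ Ioi ((2 : ℝ≥0∞) ^ N)
  · rw [indicator_of_mem h]
    calc _ ≤ ∑ _p : Finset.HasAntidiagonal.antidiagonal N, 2 ^ N * ((N : ℝ≥0∞) + 1) ^ k := by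
          refine Finset.sum_le_sum fun p _ => ?_
          obtain ⟨⟨a, b⟩, hp⟩ := p
          obtain rfl : a + b = N := by simpa using hp
          simp only [Finset.HasAntidiagonal.sigmaAntidiagonalEquivProd_apply]
          rw [indicator_of_mem h]
          gcongr
          omega
      _ = _ := by
          simp
          ring
  · rw [indicator_of_notMem h]
    refine (Finset.sum_eq_zero fun p _ => ?_).le
    obtain ⟨⟨a, b⟩, hp⟩ := p
    obtain rfl : a + b = N := by simpa using hp
    exact indicator_of_notMem h _

theorem lintegral_dyadicOrlicz {X : Type*} [MeasurableSpace X] (μ : Measure X) (k : ℕ)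
    {g : X → ℝ≥0∞} (hg : Measurable g) :
    ∫⁻ x, dyadicOrlicz k (g x) ∂μ =
      ∑' n : ℕ, 2 ^ n * ((n : ℝ≥0∞) + 1) ^ k * μ {x | 2 ^ n < g x} := by
  simp only [dyadicOrlicz]
  have hm (n : ℕ) : Measurable fun x => (Ioi ((2 : ℝ≥0∞) ^ n)).indicator
      (fun _ => 2 ^ n * ((n : ℝ≥0∞) + 1) ^ k) (g x) :=
    (measurable_const.indicator measurableSet_Ioi).comp hg
  rw [lintegral_tsum fun n => (hm n).aemeasurable]
  refine tsum_congr fun n => ?_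
  rw [← lintegral_indicator_const (measurableSet_lt measurable_const hg)]
  rfl

theorem sum_range_indicator_two_pow_le (u : ℝ≥0∞) (N : ℕ) :
    ∑ n ∈ Finset.range N, (Ioi ((2 : ℝ≥0∞) ^ n)).indicator (fun _ => 2 ^ n) u ≤ 2 * u := by
  have key (N : ℕ) : ∑ n ∈ Finset.range N, (2 : ℝ≥0∞) ^ n ≤ 2 ^ N := by
    induction N with
    | zero => simp
    | succ N ih =>
      rw [Finset.sum_range_succ, pow_succ, mul_two]
      gcongr
  induction N with
  | zero => simp
  | succ N ih =>
    by_cases h : u ∈ Ioi ((2 : ℝ≥0∞) ^ N)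
    · calc _ ≤ ∑ n ∈ Finset.range (N + 1), (2 : ℝ≥0∞) ^ n :=
            Finset.sum_le_sum fun n _ => indicator_le_self' (fun _ _ => zero_le) u
        _ ≤ 2 ^ (N + 1) := key _
        _ = 2 * 2 ^ N := pow_succ' _ _
        _ ≤ 2 * u := by gcongr; exact le_of_lt h
    · rw [Finset.sum_range_succ, indicator_of_notMem h, add_zero]
      exact ih

/-- Whenever `2 ^ n < 2 ^ m * x`, the weight `n + 1` is at most `(m + 3) * (1 + log⁺ x)`. Pulling it
out leaves a geometric sum of size at most `2 * (2 ^ m * x)`. -/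
theorem dyadicOrlicz_two_pow_mul_ofReal_le (k m : ℕ) {x : ℝ} (hx : 0 ≤ x) :
    dyadicOrlicz k (2 ^ m * ENNReal.ofReal x) ≤
      ENNReal.ofReal ((m + 3) ^ k * 2 ^ (m + 1)) *
        ENNReal.ofReal (x * (1 + Real.posLog x) ^ k) := by
  have hL : 0 ≤ Real.posLog x := Real.posLog_nonneg
  set u := 2 ^ m * ENNReal.ofReal x with hu
  have hu' : u = ENNReal.ofReal (2 ^ m * x) := by
    rw [ENNReal.ofReal_mul (by positivity), ENNReal.ofReal_pow (by norm_num)]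
    simp [hu]
  have step (n : ℕ) : (Ioi ((2 : ℝ≥0∞) ^ n)).indicator
      (fun _ => 2 ^ n * ((n : ℝ≥0∞) + 1) ^ k) u ≤
      ENNReal.ofReal (((m + 3) * (1 + Real.posLog x)) ^ k) *
        (Ioi ((2 : ℝ≥0∞) ^ n)).indicator (fun _ => 2 ^ n) u := by
    by_cases h : u ∈ Ioi ((2 : ℝ≥0∞) ^ n)
    · rw [indicator_of_mem h, indicator_of_mem h, mul_comm]
      gcongr
      have h' : (2 : ℝ) ^ n < 2 ^ m * x := by
        rw [mem_Ioi, hu'] at h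
        rw [show (2 : ℝ≥0∞) ^ n = ENNReal.ofReal (2 ^ n) by
          rw [ENNReal.ofReal_pow (by norm_num)]; simp] at h
        exact (ENNReal.ofReal_lt_ofReal_iff_of_nonneg (by positivity)).1 h
      have hx0 : 0 < x := by
        rcases hx.lt_or_eq with h0 | h0
        · exact h0
        · rw [← h0, mul_zero] at h'
          exact absurd h' (not_lt.2 (by positivity))
      have hlog := Real.log_lt_log (by positivity) h'
      rw [Real.log_mul (by positivity) hx0.ne', Real.log_pow, Real.log_pow] at hlog
      have hl2 := Real.log_two_gt_d9
      have hlp : Real.log x ≤ Real.posLog x := le_max_right _ _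
      -- The factor 2 comes from `log 2 > 1 / 2`.
      have hn : (n : ℝ) ≤ m + 2 * Real.posLog x := by
        by_contra! hcon
        nlinarith
      have hfin : (n : ℝ) + 1 ≤ (m + 3) * (1 + Real.posLog x) := by
        have : (0 : ℝ) ≤ m := Nat.cast_nonneg m
        nlinarith
      rw [ENNReal.ofReal_pow (by positivity)]
      gcongr
      calc (n : ℝ≥0∞) + 1 = ENNReal.ofReal (n + 1) := by
            rw [ENNReal.ofReal_add (by positivity) (by norm_num)]; simp
        _ ≤ _ := ENNReal.ofReal_le_ofReal hfin
    · rw [indicator_of_notMem h]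
      exact zero_le
  calc dyadicOrlicz k u ≤ ∑' n : ℕ, ENNReal.ofReal (((m + 3) * (1 + Real.posLog x)) ^ k) *
        (Ioi ((2 : ℝ≥0∞) ^ n)).indicator (fun _ => 2 ^ n) u := ENNReal.tsum_le_tsum step
    _ ≤ ENNReal.ofReal (((m + 3) * (1 + Real.posLog x)) ^ k) * (2 * u) := by
        rw [ENNReal.tsum_mul_left]
        gcongr
        exact ENNReal.summable.tsum_le_of_sum_range_le (sum_range_indicator_two_pow_le u)
    _ = _ := by
        rw [hu', ← ENNReal.ofReal_ofNat 2, ← ENNReal.ofReal_mul (by norm_num),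
          ← ENNReal.ofReal_mul (by positivity), ← ENNReal.ofReal_mul (by positivity)]
        congr 1
        rw [mul_pow]
        ring

/-! ### Weak type for countable families: Vitali covering and products -/

section Basis

variable {X Y ι κ : Type*} [MeasurableSpace X] [MeasurableSpace Y]

/-- The points lying in a member of the family `B` over which the average of `f` exceeds `1`. -/
def avgSuperlevel (μ : Measure X) (B : ι → Set X) (f : X → ℝ≥0∞) : Set X :=
  {x | ∃ i, x ∈ B i ∧ μ (B i) < ∫⁻ y in B i, f y ∂μ}

/-- The maximal operator of the family `B` is of weak type `L (log L) ^ k`. -/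
def BasisWeakType (μ : Measure X) (B : ι → Set X) (k : ℕ) : Prop :=
  ∃ C c : ℝ≥0∞, C ≠ ∞ ∧ c ≠ ∞ ∧ ∀ f : X → ℝ≥0∞, Measurable f →
    μ (avgSuperlevel μ B f) ≤ C * ∫⁻ x, dyadicOrlicz k (c * f x) ∂μ

theorem avgSuperlevel_eq_iUnion (μ : Measure X) (B : ι → Set X) (f : X → ℝ≥0∞) :
    avgSuperlevel μ B f = ⋃ i : {i // μ (B i) < ∫⁻ y in B i, f y ∂μ}, B i := by
  ext x
  simp only [avgSuperlevel, mem_ofPred_eq, mem_iUnion, Subtype.exists, exists_prop]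
  exact exists_congr fun i => and_comm

theorem measurableSet_avgSuperlevel [Countable ι] (μ : Measure X) {B : ι → Set X}
    (hB : ∀ i, MeasurableSet (B i)) (f : X → ℝ≥0∞) : MeasurableSet (avgSuperlevel μ B f) := by
  rw [avgSuperlevel_eq_iUnion]
  exact MeasurableSet.iUnion fun i => hB i

theorem measure_finite_union_le_of_engulfing {μ : Measure X} {B B' : ι → Set X}
    (hB : ∀ i, MeasurableSet (B i)) {δ : ι → ℝ} (hδ : ∀ i, 0 ≤ δ i)
    (hne : ∀ i, (B i).Nonempty)
    (hsub : ∀ i j, (B i ∩ B j).Nonempty → δ i ≤ 2 * δ j → B i ⊆ B' j)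
    {K : ℝ≥0∞} (hK : ∀ j, μ (B' j) ≤ K * μ (B j)) {h : X → ℝ≥0∞} (F : Finset ι)
    (hF : ∀ i ∈ F, μ (B i) ≤ ∫⁻ y in B i, h y ∂μ) :
    μ (⋃ i ∈ F, B i) ≤ K * ∫⁻ y, h y ∂μ := by
  obtain ⟨R, hR⟩ : ∃ R, ∀ a ∈ (F : Set ι), δ a ≤ R := by
    obtain ⟨R, hR⟩ := (F.finite_toSet.image δ).bddAbove
    exact ⟨R, fun a ha => hR (mem_image_of_mem _ ha)⟩
  obtain ⟨u, huF, hdisj, hcov⟩ := Vitali.exists_disjoint_subfamily_covering_enlargement B F δ 2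
    one_lt_two (fun a _ => hδ a) R hR (fun a _ => hne a)
  have hufin : u.Finite := F.finite_toSet.subset huF
  calc μ (⋃ i ∈ F, B i) ≤ μ (⋃ i ∈ u, B' i) := by
        refine measure_mono (iUnion₂_subset fun i hi => ?_)
        obtain ⟨b, hb, hib, hle⟩ := hcov i hi
        exact (hsub i b hib hle).trans (subset_biUnion_of_mem hb)
    _ ≤ ∑' i : u, μ (B' i) := measure_biUnion_le μ hufin.countable _
    _ ≤ ∑' i : u, K * ∫⁻ y in B i, h y ∂μ := by
        refine ENNReal.tsum_le_tsum fun i => (hK i).trans ?_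
        gcongr
        exact hF i (huF i.2)
    _ = K * ∫⁻ y in ⋃ i ∈ u, B i, h y ∂μ := by
        rw [ENNReal.tsum_mul_left, lintegral_biUnion hufin.countable (fun i _ => hB i) hdisj]
    _ ≤ K * ∫⁻ y, h y ∂μ := by
        exact mul_le_mul_right (setLIntegral_le_lintegral _ _) K

/-- Since `2 * f ≤ 1 + h` with `h` vanishing where `f ≤ 1 / 2`, an average of `f` above 1 forces an
average of `h` at least 1. Vitali's lemma is then applied to `h`. -/
theorem basisWeakType_zero_of_engulfing [Countable ι] {μ : Measure X} {B B' : ι → Set X}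
    (hB : ∀ i, MeasurableSet (B i)) {δ : ι → ℝ} (hδ : ∀ i, 0 ≤ δ i)
    (hne : ∀ i, (B i).Nonempty)
    (hsub : ∀ i j, (B i ∩ B j).Nonempty → δ i ≤ 2 * δ j → B i ⊆ B' j)
    {K : ℝ≥0∞} (hKtop : K ≠ ∞) (hK : ∀ j, μ (B' j) ≤ K * μ (B j)) (hfin : ∀ i, μ (B i) ≠ ∞) :
    BasisWeakType μ B 0 := by
  refine ⟨2 * K, 2, ENNReal.mul_ne_top (by simp) hKtop, by simp, fun f hf => ?_⟩
  set h : X → ℝ≥0∞ := fun x => 2 * dyadicOrlicz 0 (2 * f x) with hh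
  have hfh (x : X) : 2 * f x ≤ 1 + h x := by
    rcases le_or_gt (2 * f x) 1 with h1 | h1
    · exact h1.trans le_self_add
    · exact (le_two_mul_dyadicOrlicz h1).trans le_add_self
  have hmain (i : ι) (hi : μ (B i) < ∫⁻ y in B i, f y ∂μ) : μ (B i) ≤ ∫⁻ y in B i, h y ∂μ := by
    have h1 : 2 * μ (B i) ≤ μ (B i) + ∫⁻ y in B i, h y ∂μ := by
      calc 2 * μ (B i) ≤ 2 * ∫⁻ y in B i, f y ∂μ := by gcongr
        _ = ∫⁻ y in B i, 2 * f y ∂μ := (lintegral_const_mul _ hf).symm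
        _ ≤ ∫⁻ y in B i, (1 + h y) ∂μ := lintegral_mono hfh
        _ = _ := by
          rw [lintegral_add_left measurable_const]
          simp
    rw [two_mul] at h1
    exact (ENNReal.add_le_add_iff_left (hfin i)).1 h1
  -- Exhausting by finite subfamilies makes the sizes bounded, as Vitali selection requires.
  rw [avgSuperlevel_eq_iUnion, iUnion_eq_iUnion_finset]
  classical
  rw [Directed.measure_iUnion]
  · refine iSup_le fun F => ?_
    have := measure_finite_union_le_of_engulfing (μ := μ) hB hδ hne hsub hK (h := h)
      (F.map (Function.Embedding.subtype _)) (by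
        intro i hi
        obtain ⟨j, -, rfl⟩ := Finset.mem_map.1 hi
        exact hmain _ j.2)
    have hm : Measurable fun x => dyadicOrlicz 0 (2 * f x) :=
      (measurable_dyadicOrlicz 0).comp (hf.const_mul 2)
    rw [hh, lintegral_const_mul _ hm, ← mul_assoc,
      mul_comm K] at this
    refine le_trans (measure_mono ?_) this
    intro x hx
    simp only [mem_iUnion, exists_prop] at hx ⊢
    obtain ⟨i, hi, hx⟩ := hx
    exact ⟨i, Finset.mem_map_of_mem _ hi, hx⟩
  · intro F G
    refine ⟨F ∪ G, ?_, ?_⟩ <;>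
    exact biUnion_subset_biUnion_left fun i hi => by
      simp only [Finset.mem_coe, Finset.mem_union]
      tauto

/-- Iteration by Fubini: the hypothesis on `B` is used on lines in the first variable, and the layer
cake formula with the truncated bound for `D` on lines in the second. -/
theorem BasisWeakType.prod [Countable ι] [Countable κ] {μ : Measure X} {ν : Measure Y}
    [SFinite μ] [SFinite ν] {B : ι → Set X} {D : κ → Set Y} {k : ℕ}
    (hB : ∀ i, MeasurableSet (B i)) (hD : ∀ j, MeasurableSet (D j))
    (hD0 : ∀ j, ν (D j) ≠ 0) (hDtop : ∀ j, ν (D j) ≠ ∞)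
    (hwB : BasisWeakType μ B k) (hwD : BasisWeakType ν D 0) :
    BasisWeakType (μ.prod ν) (fun p : ι × κ => B p.1 ×ˢ D p.2) (k + 1) := by
  obtain ⟨C, c, hC, hc, hwB⟩ := hwB
  obtain ⟨C', c', hC', hc', hwD⟩ := hwD
  refine ⟨C * C', c' * c, ENNReal.mul_ne_top hC hC', ENNReal.mul_ne_top hc' hc, fun f hf => ?_⟩
  -- The maximal function of `f (x, ·)` along `D`; `κ` countable makes it measurable.
  set g : X × Y → ℝ≥0∞ := fun p =>
    ⨆ j, (D j).indicator (fun _ => (ν (D j))⁻¹ * ∫⁻ y in D j, f (p.1, y) ∂ν) p.2 with hg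
  have hgm : Measurable g := by
    refine Measurable.iSup fun j => ?_
    have h1 : Measurable fun x => (ν (D j))⁻¹ * ∫⁻ y in D j, f (x, y) ∂ν :=
      (Measurable.lintegral_prod_right' hf).const_mul _
    have h2 : (fun p : X × Y => (D j).indicator
        (fun _ => (ν (D j))⁻¹ * ∫⁻ y in D j, f (p.1, y) ∂ν) p.2) =
        (Prod.snd ⁻¹' D j).indicator
          (fun p : X × Y => (ν (D j))⁻¹ * ∫⁻ y in D j, f (p.1, y) ∂ν) := by
      ext p
      rfl
    rw [h2]
    exact (h1.comp measurable_fst).indicator (measurable_snd (hD j))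
  have hle (x : X) {y : Y} {j : κ} (hy : y ∈ D j) :
      ∫⁻ y in D j, f (x, y) ∂ν ≤ ν (D j) * g (x, y) := by
    have h1 : (ν (D j))⁻¹ * ∫⁻ y in D j, f (x, y) ∂ν ≤ g (x, y) := by
      refine le_trans ?_ (le_iSup _ j)
      simp only [indicator_of_mem hy, le_refl]
    calc _ = ν (D j) * ((ν (D j))⁻¹ * ∫⁻ y in D j, f (x, y) ∂ν) := by
          rw [← mul_assoc, ENNReal.mul_inv_cancel (hD0 j) (hDtop j), one_mul]
      _ ≤ _ := by gcongr
  -- Rescaling `f` by `c / 2 ^ n` moves the level `2 ^ n` of `c * g` to level 1.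
  have hslice (x : X) (n : ℕ) : ν {y | 2 ^ n < c * g (x, y)} ≤
      C' * ∫⁻ y, dyadicOrlicz 0 (c' * c * f (x, y) / 2 ^ n) ∂ν := by
    have hfx : Measurable fun y => f (x, y) := hf.comp measurable_prodMk_left
    refine (measure_mono ?_).trans ((hwD (fun y => c * f (x, y) / 2 ^ n)
      ((hfx.const_mul c).div_const _)).trans_eq ?_)
    · intro y hy
      rw [mem_ofPred_eq, hg, ENNReal.mul_iSup] at hy
      obtain ⟨j, hj⟩ := lt_iSup_iff.1 hy
      have hyj : y ∈ D j := by
        by_contra hcon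
        rw [indicator_of_notMem hcon, mul_zero] at hj
        exact not_lt_zero hj
      rw [indicator_of_mem hyj] at hj
      refine ⟨j, hyj, ?_⟩
      simp_rw [div_eq_mul_inv]
      rw [lintegral_mul_const _ (hfx.const_mul c), lintegral_const_mul _ hfx, ← div_eq_mul_inv,
        ENNReal.lt_div_iff_mul_lt (by simp) (by simp)]
      have h3 : ν (D j) * 2 ^ n < ν (D j) *
          (c * ((ν (D j))⁻¹ * ∫⁻ y in D j, f (x, y) ∂ν)) :=
        ENNReal.mul_lt_mul_right (hD0 j) (hDtop j) hj
      rwa [mul_left_comm, ← mul_assoc (ν (D j)), ENNReal.mul_inv_cancel (hD0 j) (hDtop j),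
        one_mul] at h3
    · simp only [mul_assoc, mul_div_assoc]
  have hms := measurableSet_avgSuperlevel (μ.prod ν) (fun p : ι × κ => (hB p.1).prod (hD p.2)) f
  rw [Measure.prod_apply_symm hms]
  calc ∫⁻ y, μ ((fun x => (x, y)) ⁻¹'
        avgSuperlevel (μ.prod ν) (fun p : ι × κ => B p.1 ×ˢ D p.2) f) ∂ν
      ≤ ∫⁻ y, C * ∫⁻ x, dyadicOrlicz k (c * g (x, y)) ∂μ ∂ν := by
        refine lintegral_mono fun y => ?_
        refine (measure_mono ?_).trans (hwB (fun x => g (x, y)) (hgm.comp measurable_prodMk_right))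
        -- For fixed `y` in `D j`, the average of `f` over `B i × D j` is at most the average of `g
        -- (·, y)` over `B i`.
        rintro x ⟨⟨i, j⟩, ⟨hx, hy⟩, hlt⟩
        refine ⟨i, hx, ?_⟩
        rw [Measure.prod_prod, setLIntegral_prod _ hf.aemeasurable] at hlt
        have h1 := hlt.trans_le (lintegral_mono fun x => hle x hy)
        have hm : Measurable fun x => g (x, y) := hgm.comp measurable_prodMk_right
        rw [lintegral_const_mul _ hm, mul_comm] at h1
        exact lt_of_mul_lt_mul_left h1 zero_le
    _ = C * ∫⁻ x, ∫⁻ y, dyadicOrlicz k (c * g (x, y)) ∂ν ∂μ := by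
        have hm : Measurable fun p : X × Y => dyadicOrlicz k (c * g p) :=
          (measurable_dyadicOrlicz k).comp (hgm.const_mul c)
        rw [lintegral_const_mul _ hm.lintegral_prod_left',
          lintegral_lintegral_swap (f := fun x y => dyadicOrlicz k (c * g (x, y)))
            hm.aemeasurable]
    _ ≤ C * ∫⁻ x, C' * ∫⁻ y, dyadicOrlicz (k + 1) (c' * c * f (x, y)) ∂ν ∂μ := by
        gcongr with x
        have hgx : Measurable fun y => c * g (x, y) :=
          (hgm.comp measurable_prodMk_left).const_mul c
        rw [lintegral_dyadicOrlicz ν k hgx]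
        have hm (n : ℕ) : Measurable fun y => dyadicOrlicz 0 (c' * c * f (x, y) / 2 ^ n) :=
          (measurable_dyadicOrlicz 0).comp
            (((hf.comp measurable_prodMk_left).const_mul _).div_const _)
        calc _ ≤ ∑' n : ℕ, 2 ^ n * ((n : ℝ≥0∞) + 1) ^ k *
                (C' * ∫⁻ y, dyadicOrlicz 0 (c' * c * f (x, y) / 2 ^ n) ∂ν) := by
              gcongr with n
              exact hslice x n
          _ = C' * ∫⁻ y, ∑' n : ℕ, 2 ^ n * ((n : ℝ≥0∞) + 1) ^ k *
                dyadicOrlicz 0 (c' * c * f (x, y) / 2 ^ n) ∂ν := by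
              rw [lintegral_tsum fun n => ((hm n).const_mul _).aemeasurable,
                ← ENNReal.tsum_mul_left]
              refine tsum_congr fun n => ?_
              rw [lintegral_const_mul _ (hm n)]
              ring
          _ ≤ _ := by
              gcongr with y
              exact tsum_mul_dyadicOrlicz_zero_le k _
    _ = C * C' * ∫⁻ p, dyadicOrlicz (k + 1) (c' * c * f p) ∂(μ.prod ν) := by
        have hm : Measurable fun p : X × Y => dyadicOrlicz (k + 1) (c' * c * f p) :=
          (measurable_dyadicOrlicz _).comp (hf.const_mul _)
        rw [lintegral_const_mul _ hm.lintegral_prod_right', lintegral_prod _ hm.aemeasurable,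
          mul_assoc]

end Basis

/-! ### Rational intervals and rectangles of fixed shape -/

/-- The positive rational numbers. -/
abbrev PosRat : Type := {r : ℚ // 0 < r}

/-- The closed intervals with rational endpoints. -/
def rationalInterval (p : ℚ × PosRat) : Set ℝ :=
  Icc (p.1 : ℝ) (p.1 + (p.2 : ℚ))

/-- The rectangles with side lengths `r`, `d * r` and rational parameters. -/
def rationalRectangle (d : ℝ) (p : (ℚ × ℚ) × PosRat) : Set (ℝ × ℝ) :=
  Icc (p.1.1 : ℝ) (p.1.1 + (p.2 : ℚ)) ×ˢ Icc (p.1.2 : ℝ) (p.1.2 + d * (p.2 : ℚ))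

theorem Icc_subset_of_inter_nonempty {a b r s : ℝ} (h : (Icc a (a + r) ∩ Icc b (b + s)).Nonempty)
    (hrs : r ≤ 2 * s) : Icc a (a + r) ⊆ Icc (b - 2 * s) (b + 3 * s) := by
  obtain ⟨x, ⟨h1, h2⟩, h3, h4⟩ := h
  rintro y ⟨h5, h6⟩
  constructor <;> linarith

theorem basisWeakType_rationalInterval : BasisWeakType volume rationalInterval 0 := by
  have hpos (p : ℚ × PosRat) : (0 : ℝ) < (p.2 : ℚ) := by exact_mod_cast p.2.2
  refine basisWeakType_zero_of_engulfing (δ := fun p => ((p.2 : ℚ) : ℝ))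
    (B' := fun p => Icc (p.1 - 2 * ((p.2 : ℚ) : ℝ)) (p.1 + 3 * ((p.2 : ℚ) : ℝ))) (K := 5)
    (fun i => measurableSet_Icc) (fun i => (hpos i).le)
    (fun i => nonempty_Icc.2 (by linarith [hpos i]))
    (fun i j h hij => Icc_subset_of_inter_nonempty h hij) (by simp) (fun j => ?_)
    (fun i => measure_Icc_lt_top.ne)
  rw [rationalInterval, Real.volume_Icc, Real.volume_Icc, ← ENNReal.ofReal_ofNat 5,
    ← ENNReal.ofReal_mul (by norm_num)]
  exact ENNReal.ofReal_le_ofReal (by linarith)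

/-- With `d` fixed, one parameter governs both sides, so the rectangles engulf each other like
intervals, with constant `25 = 5 ^ 2`. -/
theorem basisWeakType_rationalRectangle {d : ℝ} (hd : 0 < d) :
    BasisWeakType volume (rationalRectangle d) 0 := by
  have hpos (p : (ℚ × ℚ) × PosRat) : (0 : ℝ) < (p.2 : ℚ) := by exact_mod_cast p.2.2
  have hdpos (p : (ℚ × ℚ) × PosRat) : 0 < d * ((p.2 : ℚ) : ℝ) := mul_pos hd (hpos p)
  refine basisWeakType_zero_of_engulfing (δ := fun p => ((p.2 : ℚ) : ℝ))
    (B' := fun p => Icc (p.1.1 - 2 * ((p.2 : ℚ) : ℝ)) (p.1.1 + 3 * ((p.2 : ℚ) : ℝ)) ×ˢ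
      Icc (p.1.2 - 2 * (d * ((p.2 : ℚ) : ℝ))) (p.1.2 + 3 * (d * ((p.2 : ℚ) : ℝ)))) (K := 25)
    (fun i => measurableSet_Icc.prod measurableSet_Icc) (fun i => (hpos i).le)
    (fun i => (nonempty_Icc.2 (by linarith [hpos i])).prod
      (nonempty_Icc.2 (by linarith [hdpos i])))
    (fun i j h hij => ?_) (by simp) (fun j => ?_) (fun i => ?_)
  · rw [rationalRectangle, rationalRectangle, prod_inter_prod, prod_nonempty_iff] at h
    exact prod_mono (Icc_subset_of_inter_nonempty h.1 hij)
      (Icc_subset_of_inter_nonempty h.2 (by nlinarith))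
  · rw [rationalRectangle, Measure.volume_eq_prod, Measure.prod_prod, Measure.prod_prod,
      Real.volume_Icc, Real.volume_Icc, Real.volume_Icc, Real.volume_Icc, ← ENNReal.ofReal_ofNat 25,
      ← ENNReal.ofReal_mul (by linarith [hpos j]), ← ENNReal.ofReal_mul (by linarith [hpos j]),
      ← ENNReal.ofReal_mul (by norm_num)]
    exact ENNReal.ofReal_le_ofReal (by linarith)
  · rw [rationalRectangle, Measure.volume_eq_prod, Measure.prod_prod]
    exact ENNReal.mul_ne_top measure_Icc_lt_top.ne measure_Icc_lt_top.ne

/-! ### Transfer to maximal operators on `ℝ³` -/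

/-- The identification of `ℝ³` with an iterated product. -/
def finThreeEquiv : (Fin 3 → ℝ) ≃ᵐ (ℝ × ℝ) × ℝ where
  toFun x := ((x 0, x 1), x 2)
  invFun p := ![p.1.1, p.1.2, p.2]
  left_inv x := by
    ext i
    fin_cases i <;> rfl
  right_inv p := rfl
  measurable_toFun := by
    change Measurable fun x : Fin 3 → ℝ => ((x 0, x 1), x 2)
    fun_prop
  measurable_invFun := by
    refine measurable_pi_iff.2 fun i => ?_
    fin_cases i
    · exact measurable_fst.comp measurable_fst
    · exact measurable_snd.comp measurable_fst
    · exact measurable_snd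

theorem measurePreserving_finThreeEquiv : MeasurePreserving finThreeEquiv := by
  refine MeasurePreserving.symm finThreeEquiv.symm ⟨finThreeEquiv.symm.measurable, ?_⟩
  refine (Measure.pi_eq fun s hs => ?_).symm
  rw [finThreeEquiv.symm.map_apply]
  have : finThreeEquiv.symm ⁻¹' univ.pi s = (s 0 ×ˢ s 1) ×ˢ s 2 := by
    ext p
    simp only [mem_preimage, mem_univ_pi, Fin.forall_fin_succ, mem_prod]
    change p.1.1 ∈ s 0 ∧ p.1.2 ∈ s 1 ∧ p.2 ∈ s 2 ∧ _ ↔ _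
    simp [and_assoc]
  rw [this, Measure.volume_eq_prod, Measure.prod_prod, Measure.volume_eq_prod, Measure.prod_prod,
    Fin.prod_univ_three]

theorem exists_of_lt_maximalOperator {B : Set (Set (Fin 3 → ℝ))} {f : (Fin 3 → ℝ) → ℝ}
    {a : ℝ≥0∞} {x : Fin 3 → ℝ} (h : a < maximalOperator B f x) :
    ∃ R ∈ B, x ∈ R ∧ a < (volume R)⁻¹ * ∫⁻ y in R, ENNReal.ofReal |f y| := by
  obtain ⟨R, hR⟩ := lt_iSup_iff.1 h
  obtain ⟨hRB, hR⟩ := lt_iSup_iff.1 hR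
  obtain ⟨hx, hR⟩ := lt_iSup_iff.1 hR
  exact ⟨R, hRB, hx, hR⟩

theorem maximalOperator_congr_ae (B : Set (Set (Fin 3 → ℝ))) {f g : (Fin 3 → ℝ) → ℝ}
    (h : f =ᵐ[volume] g) : maximalOperator B f = maximalOperator B g := by
  ext x
  simp only [maximalOperator]
  refine iSup_congr fun R => iSup_congr fun _ => iSup_congr fun _ => ?_
  congr 1
  refine lintegral_congr_ae (ae_restrict_of_ae ?_)
  filter_upwards [h] with y hy
  rw [hy]

/-- Enlarging `R` to a comparable `D i` loses at most a factor `K` in the average, so `|f| / α` is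
replaced by `K * |f| / α`. -/
theorem weakTypeEstimate_of_basisWeakType {ι : Type*} [Countable ι]
    {D : ι → Set ((ℝ × ℝ) × ℝ)} {k : ℕ} (hD : ∀ i, MeasurableSet (D i))
    (hw : BasisWeakType volume D k) {B : Set (Set (Fin 3 → ℝ))} {K : ℝ≥0∞} (hK : K ≠ ∞)
    (hB : ∀ R ∈ B, volume R ≠ 0 ∧ volume R ≠ ∞ ∧
      ∃ i, R ⊆ finThreeEquiv ⁻¹' D i ∧ volume (D i) ≤ K * volume R) :
    WeakTypeEstimate B (fun x => x * (1 + Real.posLog x) ^ k) := by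
  obtain ⟨C, c, hC, hc, hw⟩ := hw
  obtain ⟨m, hm⟩ : ∃ m : ℕ, c * K ≤ 2 ^ m := by
    lift c to NNReal using hc
    lift K to NNReal using hK
    obtain ⟨m, hm⟩ := pow_unbounded_of_one_lt (c * K) one_lt_two
    exact ⟨m, by exact_mod_cast hm.le⟩
  set C' : ℝ := (m + 3) ^ k * 2 ^ (m + 1) with hC'
  -- The summand 1 keeps the constant positive when `C = 0`.
  refine ⟨C.toReal * C' + 1, by positivity, fun f hf α hα => ?_⟩
  obtain ⟨g, hg, hfg⟩ := hf
  have hrhs : ∫⁻ x, ENNReal.ofReal (|f x| / α * (1 + Real.posLog (|f x| / α)) ^ k) =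
      ∫⁻ x, ENNReal.ofReal (|g x| / α * (1 + Real.posLog (|g x| / α)) ^ k) := by
    refine lintegral_congr_ae ?_
    filter_upwards [hfg] with x hx
    rw [hx]
  rw [maximalOperator_congr_ae B hfg, hrhs]
  set G : (Fin 3 → ℝ) → ℝ≥0∞ := fun x => K * ENNReal.ofReal (|g x| / α) with hG
  have hGm : Measurable G := by
    have : Measurable fun x => |g x| / α := (hg.norm).div_const α
    exact (this.ennreal_ofReal).const_mul K
  set H : (ℝ × ℝ) × ℝ → ℝ≥0∞ := fun p => G (finThreeEquiv.symm p) with hH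
  have hHm : Measurable H := hGm.comp finThreeEquiv.symm.measurable
  have hHe (x : Fin 3 → ℝ) : H (finThreeEquiv x) = G x := by
    rw [hH]
    simp
  have hsub : {x | ENNReal.ofReal α < maximalOperator B g x} ⊆
      finThreeEquiv ⁻¹' avgSuperlevel volume D H := by
    intro x hx
    obtain ⟨R, hRB, hxR, hlt⟩ := exists_of_lt_maximalOperator hx
    obtain ⟨h0, htop, i, hRi, hle⟩ := hB R hRB
    refine ⟨i, hRi hxR, hle.trans_lt ?_⟩
    have h1 : volume R < ∫⁻ y in R, ENNReal.ofReal (|g y| / α) := by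
      have h2 : ENNReal.ofReal α * volume R < ∫⁻ y in R, ENNReal.ofReal |g y| := by
        rw [mul_comm (volume R)⁻¹, ← div_eq_mul_inv] at hlt
        exact (ENNReal.lt_div_iff_mul_lt (Or.inl h0) (Or.inl htop)).1 hlt
      simp_rw [ENNReal.ofReal_div_of_pos hα, div_eq_mul_inv]
      have hgm : Measurable fun y => ENNReal.ofReal |g y| := hg.norm.ennreal_ofReal
      rw [lintegral_mul_const _ hgm, ← div_eq_mul_inv,
        ENNReal.lt_div_iff_mul_lt (Or.inl (by simpa using hα)) (Or.inl ENNReal.ofReal_ne_top),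
        mul_comm]
      exact h2
    -- Otherwise `D i` would be null, yet its preimage contains `R`.
    have hKpos : K ≠ 0 := by
      rintro rfl
      rw [zero_mul, nonpos_iff_eq_zero] at hle
      refine h0 (measure_mono_null hRi ?_)
      rwa [measurePreserving_finThreeEquiv.measure_preimage (hD i).nullMeasurableSet]
    calc K * volume R < K * ∫⁻ y in R, ENNReal.ofReal (|g y| / α) :=
          ENNReal.mul_lt_mul_right hKpos hK h1
      _ = ∫⁻ y in R, G y := by
          have : Measurable fun x => ENNReal.ofReal (|g x| / α) :=
            ((hg.norm).div_const α).ennreal_ofReal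
          rw [hG, lintegral_const_mul _ this]
      _ ≤ ∫⁻ y in finThreeEquiv ⁻¹' D i, G y := lintegral_mono_set hRi
      _ = ∫⁻ y in finThreeEquiv ⁻¹' D i, H (finThreeEquiv y) := by simp_rw [hHe]
      _ = ∫⁻ p in D i, H p :=
          measurePreserving_finThreeEquiv.setLIntegral_comp_preimage (hD i) hHm
  calc volume {x | ENNReal.ofReal α < maximalOperator B g x}
      ≤ volume (finThreeEquiv ⁻¹' avgSuperlevel volume D H) := measure_mono hsub
    _ = volume (avgSuperlevel volume D H) :=
        measurePreserving_finThreeEquiv.measure_preimage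
          (measurableSet_avgSuperlevel volume hD H).nullMeasurableSet
    _ ≤ C * ∫⁻ p, dyadicOrlicz k (c * H p) := hw H hHm
    _ = C * ∫⁻ x, dyadicOrlicz k (c * H (finThreeEquiv x)) := by
        have : Measurable fun p => dyadicOrlicz k (c * H p) :=
          (measurable_dyadicOrlicz k).comp (hHm.const_mul c)
        rw [measurePreserving_finThreeEquiv.lintegral_comp this]
    _ ≤ C * ∫⁻ x, ENNReal.ofReal C' *
          ENNReal.ofReal (|g x| / α * (1 + Real.posLog (|g x| / α)) ^ k) := by
        gcongr with x
        refine (dyadicOrlicz_mono k ?_).trans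
          (dyadicOrlicz_two_pow_mul_ofReal_le k m (x := |g x| / α) (by positivity))
        rw [hHe, hG, ← mul_assoc]
        gcongr
    _ = C * ENNReal.ofReal C' *
          ∫⁻ x, ENNReal.ofReal (|g x| / α * (1 + Real.posLog (|g x| / α)) ^ k) := by
        rw [lintegral_const_mul' _ _ ENNReal.ofReal_ne_top, mul_assoc]
    _ ≤ _ := by
        gcongr
        conv_lhs => rw [← ENNReal.ofReal_toReal hC]
        rw [← ENNReal.ofReal_mul ENNReal.toReal_nonneg]
        exact ENNReal.ofReal_le_ofReal (by linarith)

theorem WeakTypeEstimate.union {B B' : Set (Set (Fin 3 → ℝ))} {φ : ℝ → ℝ}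
    (h : WeakTypeEstimate B φ) (h' : WeakTypeEstimate B' φ) : WeakTypeEstimate (B ∪ B') φ := by
  obtain ⟨C, hC, h⟩ := h
  obtain ⟨C', hC', h'⟩ := h'
  refine ⟨C + C', by positivity, fun f hf α hα => ?_⟩
  calc volume {x | ENNReal.ofReal α < maximalOperator (B ∪ B') f x}
      ≤ volume ({x | ENNReal.ofReal α < maximalOperator B f x} ∪
          {x | ENNReal.ofReal α < maximalOperator B' f x}) := by
        refine measure_mono fun x hx => ?_
        obtain ⟨R, hR, hxR, hlt⟩ := exists_of_lt_maximalOperator hx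
        rcases hR with hR | hR
        · exact Or.inl (hlt.trans_le
            (le_iSup_of_le R (le_iSup_of_le hR (le_iSup_of_le hxR le_rfl))))
        · exact Or.inr (hlt.trans_le
            (le_iSup_of_le R (le_iSup_of_le hR (le_iSup_of_le hxR le_rfl))))
    _ ≤ _ := (measure_union_le _ _).trans (add_le_add (h f hf α hα) (h' f hf α hα))
    _ = _ := by rw [ENNReal.ofReal_add hC.le hC'.le, add_mul]

/-! ### Upper bounds for the bases -/

theorem volume_Icc_add (a : Fin 3 → ℝ) {s t u : ℝ} (hs : 0 ≤ s) (ht : 0 ≤ t) :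
    volume (Icc a (a + ![s, t, u])) = ENNReal.ofReal (s * t * u) := by
  rw [Real.volume_Icc_pi, Fin.prod_univ_three]
  simp [ENNReal.ofReal_mul, hs, ht, mul_nonneg]

theorem exists_rational_mem_Ioo_two_mul {s : ℝ} (hs : 0 < s) :
    ∃ r : PosRat, s < ((r : ℚ) : ℝ) ∧ ((r : ℚ) : ℝ) < 2 * s := by
  obtain ⟨r, h1, h2⟩ := exists_rat_btwn (show s < 2 * s by linarith)
  exact ⟨⟨r, by exact_mod_cast hs.trans h1⟩, h1, h2⟩

/-- The strict inequality leaves room to move the left endpoint to a rational. -/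
theorem exists_rational_Icc_subset {s r : ℝ} (a : ℝ) (h : s < r) :
    ∃ q : ℚ, Icc a (a + s) ⊆ Icc (q : ℝ) (q + r) := by
  obtain ⟨q, h1, h2⟩ := exists_rat_btwn (show a + s - r < a by linarith)
  exact ⟨q, Icc_subset_Icc h2.le (by linarith)⟩

theorem mem_finThreeEquiv_preimage_of_mem_Icc {a x v : Fin 3 → ℝ} (hx : x ∈ Icc a (a + v))
    {A B C : Set ℝ} (hA : Icc (a 0) (a 0 + v 0) ⊆ A) (hB : Icc (a 1) (a 1 + v 1) ⊆ B)
    (hC : Icc (a 2) (a 2 + v 2) ⊆ C) : x ∈ finThreeEquiv ⁻¹' ((A ×ˢ B) ×ˢ C) :=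
  ⟨⟨hA ⟨hx.1 0, hx.2 0⟩, hB ⟨hx.1 1, hx.2 1⟩⟩, hC ⟨hx.1 2, hx.2 2⟩⟩

theorem volume_rationalInterval (p : ℚ × PosRat) :
    volume (rationalInterval p) = ENNReal.ofReal ((p.2 : ℚ) : ℝ) := by
  rw [rationalInterval, Real.volume_Icc, add_sub_cancel_left]

theorem volume_rationalInterval_ne_zero (p : ℚ × PosRat) :
    volume (rationalInterval p) ≠ 0 := by
  rw [volume_rationalInterval]
  have : (0 : ℝ) < (p.2 : ℚ) := by exact_mod_cast p.2.2
  simpa using this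

theorem volume_rationalInterval_ne_top (p : ℚ × PosRat) :
    volume (rationalInterval p) ≠ ∞ := by
  rw [volume_rationalInterval]
  exact ENNReal.ofReal_ne_top

theorem measurableSet_rationalInterval (p : ℚ × PosRat) :
    MeasurableSet (rationalInterval p) := measurableSet_Icc

theorem measurableSet_rationalRectangle (d : ℝ) (p : (ℚ × ℚ) × PosRat) :
    MeasurableSet (rationalRectangle d p) := measurableSet_Icc.prod measurableSet_Icc

theorem mul_mul_le_eight_mul {s t u s' t' u' : ℝ} (hs' : 0 ≤ s') (ht' : 0 ≤ t')
    (hu' : 0 ≤ u') (h1 : s' ≤ 2 * s) (h2 : t' ≤ 2 * t) (h3 : u' ≤ 2 * u) :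
    ENNReal.ofReal (s' * t' * u') ≤ 8 * ENNReal.ofReal (s * t * u) := by
  rw [← ENNReal.ofReal_ofNat 8, ← ENNReal.ofReal_mul (by norm_num)]
  refine ENNReal.ofReal_le_ofReal ?_
  calc s' * t' * u' ≤ (2 * s) * (2 * t) * (2 * u) := by
        have : 0 ≤ 2 * s * (2 * t) := mul_nonneg (by linarith) (by linarith)
        gcongr
        linarith
    _ = _ := by ring

theorem basisWeakType_rationalInterval_prod :
    BasisWeakType (volume.prod volume) (fun p : (ℚ × PosRat) × (ℚ × PosRat) =>
      rationalInterval p.1 ×ˢ rationalInterval p.2) 1 :=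
  basisWeakType_rationalInterval.prod measurableSet_rationalInterval
    measurableSet_rationalInterval volume_rationalInterval_ne_zero volume_rationalInterval_ne_top
    basisWeakType_rationalInterval

/-- The boxes with sides parallel to the axes and rational parameters. -/
def rationalBox (p : ((ℚ × PosRat) × (ℚ × PosRat)) × (ℚ × PosRat)) : Set ((ℝ × ℝ) × ℝ) :=
  (rationalInterval p.1.1 ×ˢ rationalInterval p.1.2) ×ˢ rationalInterval p.2

/-- The boxes with side lengths `r`, `d * r`, `t` and rational parameters. -/
def rationalZygmundBox (d : ℝ) (p : ((ℚ × ℚ) × PosRat) × (ℚ × PosRat)) : Set ((ℝ × ℝ) × ℝ) :=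
  rationalRectangle d p.1 ×ˢ rationalInterval p.2

theorem measurableSet_rationalBox (p : ((ℚ × PosRat) × (ℚ × PosRat)) × (ℚ × PosRat)) :
    MeasurableSet (rationalBox p) :=
  ((measurableSet_rationalInterval p.1.1).prod (measurableSet_rationalInterval p.1.2)).prod
    (measurableSet_rationalInterval p.2)

theorem measurableSet_rationalZygmundBox (d : ℝ) (p : ((ℚ × ℚ) × PosRat) × (ℚ × PosRat)) :
    MeasurableSet (rationalZygmundBox d p) :=
  (measurableSet_rationalRectangle d p.1).prod (measurableSet_rationalInterval p.2)

theorem basisWeakType_rationalBox : BasisWeakType volume rationalBox 2 :=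
  BasisWeakType.prod (B := fun p : (ℚ × PosRat) × (ℚ × PosRat) =>
      rationalInterval p.1 ×ˢ rationalInterval p.2)
    (fun p => (measurableSet_rationalInterval p.1).prod (measurableSet_rationalInterval p.2))
    measurableSet_rationalInterval volume_rationalInterval_ne_zero volume_rationalInterval_ne_top
    basisWeakType_rationalInterval_prod basisWeakType_rationalInterval

theorem basisWeakType_rationalZygmundBox {d : ℝ} (hd : 0 < d) :
    BasisWeakType volume (rationalZygmundBox d) 1 :=
  BasisWeakType.prod (measurableSet_rationalRectangle d) measurableSet_rationalInterval
    volume_rationalInterval_ne_zero volume_rationalInterval_ne_top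
    (basisWeakType_rationalRectangle hd) basisWeakType_rationalInterval

/-- The relation between the sides is forgotten: all three are enlarged independently, by a factor
at most 2 each. -/
theorem weakTypeEstimate_zygmundBasis_two (S : Set ℤ) :
    WeakTypeEstimate (zygmundBasis S) (fun x => x * (1 + Real.posLog x) ^ 2) := by
  refine weakTypeEstimate_of_basisWeakType (K := 8) measurableSet_rationalBox
    basisWeakType_rationalBox (by simp) ?_
  rintro R ⟨j, hj, s, t, hs, ht, a, rfl⟩
  have hs' : 0 < (2 : ℝ) ^ j * s := by positivity
  rw [volume_Icc_add a hs.le hs'.le]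
  refine ⟨by simp only [ne_eq, ENNReal.ofReal_eq_zero, not_le]; positivity,
    ENNReal.ofReal_ne_top, ?_⟩
  obtain ⟨r₁, hr₁, hr₁'⟩ := exists_rational_mem_Ioo_two_mul hs
  obtain ⟨r₂, hr₂, hr₂'⟩ := exists_rational_mem_Ioo_two_mul hs'
  obtain ⟨r₃, hr₃, hr₃'⟩ := exists_rational_mem_Ioo_two_mul ht
  obtain ⟨q₁, hq₁⟩ := exists_rational_Icc_subset (a 0) hr₁
  obtain ⟨q₂, hq₂⟩ := exists_rational_Icc_subset (a 1) hr₂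
  obtain ⟨q₃, hq₃⟩ := exists_rational_Icc_subset (a 2) hr₃
  refine ⟨(((q₁, r₁), (q₂, r₂)), (q₃, r₃)),
    fun x hx => mem_finThreeEquiv_preimage_of_mem_Icc hx hq₁ hq₂ hq₃, ?_⟩
  rw [rationalBox, Measure.volume_eq_prod, Measure.prod_prod, Measure.volume_eq_prod,
    Measure.prod_prod, volume_rationalInterval, volume_rationalInterval, volume_rationalInterval,
    ← ENNReal.ofReal_mul (by linarith), ← ENNReal.ofReal_mul (by nlinarith)]
  exact mul_mul_le_eight_mul (by linarith) (by linarith) (by linarith) hr₁'.le hr₂'.le hr₃'.le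

theorem weakTypeEstimate_zygmundBasis_singleton (j : ℤ) :
    WeakTypeEstimate (zygmundBasis {j}) (fun x => x * (1 + Real.posLog x)) := by
  have hd : (0 : ℝ) < 2 ^ j := by positivity
  have hmain := weakTypeEstimate_of_basisWeakType (B := zygmundBasis {j}) (K := 8)
    (measurableSet_rationalZygmundBox _) (basisWeakType_rationalZygmundBox hd) (by simp) ?_
  · simpa using hmain
  rintro R ⟨i, hi, s, t, hs, ht, a, rfl⟩
  rw [mem_singleton_iff.1 hi]
  have hs' : 0 < (2 : ℝ) ^ j * s := by positivity
  rw [volume_Icc_add a hs.le hs'.le]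
  refine ⟨by simp only [ne_eq, ENNReal.ofReal_eq_zero, not_le]; positivity,
    ENNReal.ofReal_ne_top, ?_⟩
  obtain ⟨r₁, hr₁, hr₁'⟩ := exists_rational_mem_Ioo_two_mul hs
  obtain ⟨r₃, hr₃, hr₃'⟩ := exists_rational_mem_Ioo_two_mul ht
  -- The second side must keep the ratio `2 ^ j`, so it is determined by `r₁` rather than chosen.
  have hr₂ : (2 : ℝ) ^ j * s < 2 ^ j * ((r₁ : ℚ) : ℝ) := by gcongr
  obtain ⟨q₁, hq₁⟩ := exists_rational_Icc_subset (a 0) hr₁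
  obtain ⟨q₂, hq₂⟩ := exists_rational_Icc_subset (a 1) hr₂
  obtain ⟨q₃, hq₃⟩ := exists_rational_Icc_subset (a 2) hr₃
  refine ⟨(((q₁, q₂), r₁), (q₃, r₃)),
    fun x hx => mem_finThreeEquiv_preimage_of_mem_Icc hx hq₁ hq₂ hq₃, ?_⟩
  rw [rationalZygmundBox, Measure.volume_eq_prod, Measure.prod_prod, rationalRectangle, Measure.volume_eq_prod,
    Measure.prod_prod, Real.volume_Icc, Real.volume_Icc, add_sub_cancel_left, add_sub_cancel_left,
    volume_rationalInterval, ← ENNReal.ofReal_mul (by linarith),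
    ← ENNReal.ofReal_mul (by nlinarith)]
  exact mul_mul_le_eight_mul (by linarith) (by linarith) (by linarith) hr₁'.le (by nlinarith)
    hr₃'.le

theorem weakTypeEstimate_empty (φ : ℝ → ℝ) : WeakTypeEstimate ∅ φ := by
  refine ⟨1, one_pos, fun f _ α _ => ?_⟩
  simp [maximalOperator]

theorem zygmundBasis_insert (j : ℤ) (S : Set ℤ) :
    zygmundBasis (insert j S) = zygmundBasis {j} ∪ zygmundBasis S := by
  ext R
  simp [zygmundBasis, or_and_right, exists_or]

theorem weakTypeEstimate_zygmundBasis_of_finite {S : Set ℤ} (hS : S.Finite) :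
    WeakTypeEstimate (zygmundBasis S) (fun x => x * (1 + Real.posLog x)) := by
  induction S, hS using Set.Finite.induction_on with
  | empty =>
    have : zygmundBasis ∅ = ∅ := by
      ext R
      simp [zygmundBasis]
    rw [this]
    exact weakTypeEstimate_empty _
  | insert _ _ ih =>
    rw [zygmundBasis_insert]
    exact (weakTypeEstimate_zygmundBasis_singleton _).union ih

/-! ### A criterion for sharpness -/

/-- If the level sets of `M_B 1_Q` at height `4⁻ⁿ / 2` have measure at least a multiple of
`n ^ k * 4 ^ n * |Q|`, then `M_B` is not of weak type `φ` for any `φ = o(x (log x) ^ k)`. -/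
theorem not_weakTypeEstimate_of_lowerBound {B : Set (Set (Fin 3 → ℝ))} {k : ℕ} {c : ℝ}
    (hc : 0 < c)
    (h : ∀ n : ℕ, 1 ≤ n → ∃ Q : Set (Fin 3 → ℝ), MeasurableSet Q ∧ volume Q ≠ 0 ∧ volume Q ≠ ∞ ∧
      ENNReal.ofReal (c * n ^ k * 4 ^ n) * volume Q ≤
        volume {x | ENNReal.ofReal (1 / (2 * 4 ^ n)) < maximalOperator B (Q.indicator 1) x})
    {φ : ℝ → ℝ} (hφ : IsConvexIncreasing φ)
    (hlim : Filter.Tendsto (fun x => φ x / (x * Real.log (1 + x) ^ k)) Filter.atTop (nhds 0)) :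
    ¬ WeakTypeEstimate B φ := by
  rintro ⟨C, hC, hw⟩
  have key (n : ℕ) (hn : 1 ≤ n) : c * n ^ k * 4 ^ n ≤ C * φ (2 * 4 ^ n) := by
    obtain ⟨Q, hQ, hQ0, hQtop, hlow⟩ := h n hn
    have hφ0 : 0 ≤ φ (2 * 4 ^ n) := hφ.nonneg _ (by positivity)
    have hup := hw (Q.indicator 1) (aemeasurable_one.indicator hQ) (1 / (2 * 4 ^ n))
      (by positivity)
    have hint : ∫⁻ x, ENNReal.ofReal (φ (|Q.indicator 1 x| / (1 / (2 * 4 ^ n)))) =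
        ENNReal.ofReal (φ (2 * 4 ^ n)) * volume Q := by
      rw [← lintegral_indicator_const hQ]
      refine lintegral_congr fun x => ?_
      by_cases hx : x ∈ Q
      · simp [hx]
      · simp [hx, hφ.map_zero]
    rw [hint, ← mul_assoc, ← ENNReal.ofReal_mul hC.le] at hup
    have := (ENNReal.mul_le_mul_iff_left hQ0 hQtop).1 (hlow.trans hup)
    exact (ENNReal.ofReal_le_ofReal_iff (by positivity)).1 this
  -- Chosen so that, with `log (1 + 2 * 4 ^ n) ≤ 4 * n`, the quantity `C * φ (2 * 4 ^ n)` falls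
  -- below half of the lower bound in `key`.
  have hε : 0 < c / (4 * C * 4 ^ k) := by positivity
  have hev := hlim.eventually (gt_mem_nhds hε)
  have htop : Filter.Tendsto (fun n : ℕ => 2 * (4 : ℝ) ^ n) Filter.atTop Filter.atTop :=
    (tendsto_pow_atTop_atTop_of_one_lt (by norm_num)).const_mul_atTop (by norm_num)
  obtain ⟨n, hn, hn1⟩ := ((htop.eventually hev).and (Filter.eventually_ge_atTop 1)).exists
  have hn0 : (0 : ℝ) < n := by exact_mod_cast hn1
  have hpow : (1 : ℝ) ≤ 4 ^ n := one_le_pow₀ (by norm_num)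
  have hlogpos : 0 < Real.log (1 + 2 * 4 ^ n) := Real.log_pos (by linarith)
  rw [div_lt_iff₀ (by positivity)] at hn
  have hlog : Real.log (1 + 2 * 4 ^ n) ≤ 4 * n := by
    have h1 : Real.log (1 + 2 * 4 ^ n) ≤ Real.log (2 ^ (2 * (n + 1))) := by
      refine Real.log_le_log (by positivity) ?_
      rw [pow_mul, pow_succ]
      norm_num
      linarith
    rw [Real.log_pow] at h1
    push_cast at h1
    have h2 := Real.log_two_lt_d9
    have h3 : (1 : ℝ) ≤ n := by exact_mod_cast hn1
    nlinarith
  have h1 : φ (2 * 4 ^ n) < c / (4 * C * 4 ^ k) * (2 * 4 ^ n * (4 * n) ^ k) := by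
    refine hn.trans_le ?_
    gcongr
  have h2 := key n hn1
  have h3 : C * φ (2 * 4 ^ n) < C * (c / (4 * C * 4 ^ k) * (2 * 4 ^ n * (4 * n) ^ k)) := by
    gcongr
  have h4 : C * (c / (4 * C * 4 ^ k) * (2 * 4 ^ n * (4 * n) ^ k)) = c * n ^ k * 4 ^ n / 2 := by
    rw [mul_pow]
    field_simp
    ring
  have h5 : 0 < c * n ^ k * 4 ^ n := by positivity
  linarith

/-! ### Lower bound with one logarithm -/

/-- The product of three subsets of the line as a subset of `ℝ³`. -/
def prodThree (A B C : Set ℝ) : Set (Fin 3 → ℝ) := finThreeEquiv ⁻¹' ((A ×ˢ B) ×ˢ C)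

theorem mem_prodThree {A B C : Set ℝ} {x : Fin 3 → ℝ} :
    x ∈ prodThree A B C ↔ (x 0 ∈ A ∧ x 1 ∈ B) ∧ x 2 ∈ C := Iff.rfl

theorem measurableSet_prodThree {A B C : Set ℝ} (hA : MeasurableSet A) (hB : MeasurableSet B)
    (hC : MeasurableSet C) : MeasurableSet (prodThree A B C) :=
  finThreeEquiv.measurable ((hA.prod hB).prod hC)

theorem volume_prodThree {A B C : Set ℝ} (hA : MeasurableSet A) (hB : MeasurableSet B)
    (hC : MeasurableSet C) :
    volume (prodThree A B C) = volume A * volume B * volume C := by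
  rw [prodThree, measurePreserving_finThreeEquiv.measure_preimage
    ((hA.prod hB).prod hC).nullMeasurableSet, Measure.volume_eq_prod, Measure.prod_prod,
    Measure.volume_eq_prod, Measure.prod_prod]

/-- Here `I × J × K` lies in a box of the basis and contains `x`, while `I' × J' × K'` lies in its
intersection with `Q = A × B × C`; its volume bounds the average from below. -/
theorem lt_maximalOperator_indicator {S : Set ℤ} {j : ℤ} (hj : j ∈ S) {s t : ℝ} (hs : 0 < s)
    (ht : 0 < t) {a₀ a₁ a₂ : ℝ} {A B C I J K : Set ℝ} (hA : MeasurableSet A)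
    (hB : MeasurableSet B) (hC : MeasurableSet C) (hI : I ⊆ Icc a₀ (a₀ + s))
    (hJ : J ⊆ Icc a₁ (a₁ + 2 ^ j * s)) (hK : K ⊆ Icc a₂ (a₂ + t)) {x : Fin 3 → ℝ}
    (hx : x ∈ prodThree I J K) {I' J' K' : Set ℝ} (hI' : I' ⊆ I ∩ A) (hJ' : J' ⊆ J ∩ B)
    (hK' : K' ⊆ K ∩ C) (mI : MeasurableSet I') (mJ : MeasurableSet J') (mK : MeasurableSet K')
    {α : ℝ} (h : ENNReal.ofReal α * ENNReal.ofReal (s * (2 ^ j * s) * t) <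
      volume I' * volume J' * volume K') :
    ENNReal.ofReal α < maximalOperator (zygmundBasis S) ((prodThree A B C).indicator 1) x := by
  set a : Fin 3 → ℝ := ![a₀, a₁, a₂]
  have hmem {y : Fin 3 → ℝ} (hy : y ∈ prodThree I J K) : y ∈ Icc a (a + ![s, 2 ^ j * s, t]) := by
    obtain ⟨⟨h0, h1⟩, h2⟩ := mem_prodThree.1 hy
    have h0 := hI h0
    have h1 := hJ h1
    have h2 := hK h2
    refine ⟨fun i => ?_, fun i => ?_⟩
    · fin_cases i
      exacts [h0.1, h1.1, h2.1]
    · fin_cases i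
      exacts [h0.2, h1.2, h2.2]
  set R : Set (Fin 3 → ℝ) := Icc a (a + ![s, 2 ^ j * s, t]) with hR
  have hs' : 0 < (2 : ℝ) ^ j * s := by positivity
  have hvol : volume R = ENNReal.ofReal (s * (2 ^ j * s) * t) := volume_Icc_add a hs.le hs'.le
  have hQ : MeasurableSet (prodThree A B C) := measurableSet_prodThree hA hB hC
  have hint : ∫⁻ y in R, ENNReal.ofReal |(prodThree A B C).indicator 1 y| =
      volume (prodThree A B C ∩ R) := by
    rw [← Measure.restrict_apply hQ, ← lintegral_indicator_one hQ]
    refine lintegral_congr fun y => ?_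
    by_cases hy : y ∈ prodThree A B C <;> simp [hy]
  refine lt_of_lt_of_le ?_ (le_iSup_of_le R (le_iSup_of_le ⟨j, hj, s, t, hs, ht, a, rfl⟩
    (le_iSup_of_le (hmem hx) le_rfl)))
  rw [hint, hvol, mul_comm, ← div_eq_mul_inv, ENNReal.lt_div_iff_mul_lt
    (Or.inl (by simp only [ne_eq, ENNReal.ofReal_eq_zero, not_le]; positivity))
    (Or.inl ENNReal.ofReal_ne_top)]
  refine h.trans_le ?_
  rw [← volume_prodThree mI mJ mK]
  refine measure_mono fun y hy => ?_
  obtain ⟨⟨h0, h1⟩, h2⟩ := mem_prodThree.1 hy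
  exact ⟨⟨⟨(hI' h0).2, (hJ' h1).2⟩, (hK' h2).2⟩, hmem ⟨⟨(hI' h0).1, (hJ' h1).1⟩, (hK' h2).1⟩⟩

theorem exists_lowerBound_one {S : Set ℤ} (hS : S.Nonempty) (n : ℕ) :
    ∃ Q : Set (Fin 3 → ℝ), MeasurableSet Q ∧ volume Q ≠ 0 ∧ volume Q ≠ ∞ ∧
      ENNReal.ofReal (1 / 2 * n ^ 1 * 4 ^ n) * volume Q ≤
        volume {x | ENNReal.ofReal (1 / (2 * 4 ^ n)) <
          maximalOperator (zygmundBasis S) (Q.indicator 1) x} := by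
  obtain ⟨j, hj⟩ := hS
  have hd : (0 : ℝ) < 2 ^ j := by positivity
  have hvQ : volume (prodThree (Ico 0 1) (Ico 0 (2 ^ j)) (Ico 0 1)) = ENNReal.ofReal (2 ^ j) := by
    rw [volume_prodThree measurableSet_Ico measurableSet_Ico measurableSet_Ico]
    simp
  -- The outer half, in the first coordinate, of a box of volume `4 ^ n * |Q|` containing `Q`.
  -- Distinct dyadic ranges of the first coordinate make these disjoint.
  set E : ℕ → Set (Fin 3 → ℝ) := fun a =>
    prodThree (Ico (2 ^ a) (2 ^ (a + 1))) (Ico 0 (2 ^ j * 2 ^ (a + 1))) (Ico 0 (4 ^ (n - 1 - a)))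
    with hE
  have hEm (a : ℕ) : MeasurableSet (E a) :=
    measurableSet_prodThree measurableSet_Ico measurableSet_Ico measurableSet_Ico
  have hpow {a : ℕ} (ha : a < n) : (4 : ℝ) ^ n = 4 * ((2 ^ a) ^ 2 * 4 ^ (n - 1 - a)) := by
    obtain ⟨m, rfl⟩ : ∃ m, n = a + m + 1 := ⟨n - 1 - a, by omega⟩
    rw [show a + m + 1 - 1 - a = m by omega, pow_succ, pow_add, ← pow_mul, mul_comm a, pow_mul]
    norm_num
    ring
  have hvE {a : ℕ} (ha : a < n) : volume (E a) = ENNReal.ofReal (1 / 2 * 4 ^ n * 2 ^ j) := by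
    rw [hE, volume_prodThree measurableSet_Ico measurableSet_Ico measurableSet_Ico,
      Real.volume_Ico, Real.volume_Ico, Real.volume_Ico, ← ENNReal.ofReal_mul (by
        rw [pow_succ]; linarith [show (0 : ℝ) < 2 ^ a by positivity]),
      ← ENNReal.ofReal_mul (by
        rw [pow_succ]; nlinarith [show (0 : ℝ) < 2 ^ a by positivity,
          show (0 : ℝ) < 2 ^ j * 2 ^ a by positivity]), hpow ha]
    congr 1
    ring
  have hdisj : (↑(Finset.range n) : Set ℕ).PairwiseDisjoint E := by
    intro a _ b _ hab
    refine disjoint_left.2 fun x hxa hxb => hab ?_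
    have h1 := hxa.1.1
    have h2 := hxb.1.1
    have h3 : (2 : ℝ) ^ a < 2 ^ (b + 1) := h1.1.trans_lt h2.2
    have h4 : (2 : ℝ) ^ b < 2 ^ (a + 1) := h2.1.trans_lt h1.2
    rw [pow_lt_pow_iff_right₀ one_lt_two] at h3 h4
    omega
  refine ⟨prodThree (Ico 0 1) (Ico 0 (2 ^ j)) (Ico 0 1),
    measurableSet_prodThree measurableSet_Ico measurableSet_Ico measurableSet_Ico, ?_, ?_, ?_⟩
  · rw [hvQ]
    simpa using hd
  · rw [hvQ]
    exact ENNReal.ofReal_ne_top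
  · calc _ = ∑ a ∈ Finset.range n, volume (E a) := by
          rw [hvQ, Finset.sum_congr rfl fun a ha => hvE (Finset.mem_range.1 ha), Finset.sum_const,
            Finset.card_range, nsmul_eq_mul, ← ENNReal.ofReal_mul (by positivity),
            ← ENNReal.ofReal_natCast, ← ENNReal.ofReal_mul (by positivity)]
          congr 1
          ring
      _ = volume (⋃ a ∈ Finset.range n, E a) :=
          (measure_biUnion_finset hdisj fun a _ => hEm a).symm
      _ ≤ _ := by
          refine measure_mono (iUnion₂_subset fun a ha x hx => ?_)
          have ha := Finset.mem_range.1 ha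
          have h2a : (1 : ℝ) ≤ 2 ^ (a + 1) := one_le_pow₀ one_le_two
          have h4a : (1 : ℝ) ≤ 4 ^ (n - 1 - a) := one_le_pow₀ (by norm_num)
          refine lt_maximalOperator_indicator hj (s := 2 ^ (a + 1)) (t := 4 ^ (n - 1 - a))
            (a₀ := 0) (a₁ := 0) (a₂ := 0) (by positivity) (by positivity) measurableSet_Ico
            measurableSet_Ico measurableSet_Ico (I := Ico 0 (2 ^ (a + 1)))
            (J := Ico 0 (2 ^ j * 2 ^ (a + 1))) (K := Ico 0 (4 ^ (n - 1 - a)))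
            (by simpa using Ico_subset_Icc_self) (by simpa using Ico_subset_Icc_self)
            (by simpa using Ico_subset_Icc_self)
            ⟨⟨⟨le_trans (by positivity) hx.1.1.1, hx.1.1.2⟩, hx.1.2⟩, hx.2⟩
            (I' := Ico 0 1) (J' := Ico 0 (2 ^ j)) (K' := Ico 0 1)
            (subset_inter (Ico_subset_Ico_right h2a) subset_rfl)
            (subset_inter (Ico_subset_Ico_right (le_mul_of_one_le_right hd.le h2a)) subset_rfl)
            (subset_inter (Ico_subset_Ico_right h4a) subset_rfl) measurableSet_Ico
            measurableSet_Ico measurableSet_Ico ?_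
          rw [Real.volume_Ico, Real.volume_Ico, ← ENNReal.ofReal_mul (by positivity), sub_zero,
            sub_zero, ENNReal.ofReal_one, one_mul, mul_one, hpow ha]
          refine (ENNReal.ofReal_lt_ofReal_iff hd).2 ?_
          have h0 : (0 : ℝ) < 2 ^ a := by positivity
          field_simp
          rw [pow_succ 2 a]
          nlinarith

/-! ### Exchanging the first two axes -/

/-- The coordinate swap `(x₀, x₁, x₂) ↦ (x₁, x₀, x₂)`. -/
def swapEquiv : (Fin 3 → ℝ) ≃ᵐ (Fin 3 → ℝ) :=
  MeasurableEquiv.arrowCongr' (Equiv.swap 0 1) (MeasurableEquiv.refl ℝ)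

theorem swapEquiv_apply (x : Fin 3 → ℝ) (i : Fin 3) : swapEquiv x i = x (Equiv.swap 0 1 i) := rfl

theorem measurePreserving_swapEquiv : MeasurePreserving swapEquiv :=
  volume_preserving_arrowCongr' _ _ (MeasurePreserving.id _)

theorem swapEquiv_swapEquiv (x : Fin 3 → ℝ) : swapEquiv (swapEquiv x) = x := by
  ext i
  simp [swapEquiv_apply]

theorem preimage_swapEquiv_mem_zygmundBasis {S : Set ℤ} {R : Set (Fin 3 → ℝ)}
    (hR : R ∈ zygmundBasis S) : swapEquiv ⁻¹' R ∈ zygmundBasis (Neg.neg ⁻¹' S) := by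
  obtain ⟨j, hj, s, t, hs, ht, a, rfl⟩ := hR
  refine ⟨-j, by simpa using hj, 2 ^ j * s, t, by positivity, ht, swapEquiv a, ?_⟩
  have h1 : (2 : ℝ) ^ (-j) * (2 ^ j * s) = s := by
    rw [← mul_assoc, ← zpow_add₀ two_ne_zero, neg_add_cancel, zpow_zero, one_mul]
  rw [h1]
  ext x
  simp only [mem_preimage, mem_Icc, Pi.le_def, Fin.forall_fin_succ, Pi.add_apply, swapEquiv_apply]
  simp [Equiv.swap_apply_def]
  tauto

theorem WeakTypeEstimate.zygmundBasis_neg {S : Set ℤ} {φ : ℝ → ℝ}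
    (h : WeakTypeEstimate (zygmundBasis S) φ) :
    WeakTypeEstimate (zygmundBasis (Neg.neg ⁻¹' S)) φ := by
  obtain ⟨C, hC, h⟩ := h
  refine ⟨C, hC, fun f hf α hα => ?_⟩
  have hσ := measurePreserving_swapEquiv
  have hfσ : AEMeasurable (fun x => f (swapEquiv x)) := hf.comp_quasiMeasurePreserving hσ.quasiMeasurePreserving
  have hsub : {x | ENNReal.ofReal α < maximalOperator (zygmundBasis (Neg.neg ⁻¹' S)) f x} ⊆
      swapEquiv ⁻¹' {x | ENNReal.ofReal α <
        maximalOperator (zygmundBasis S) (fun x => f (swapEquiv x)) x} := by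
    intro x hx
    obtain ⟨R, hR, hxR, hlt⟩ := exists_of_lt_maximalOperator hx
    have hR' := preimage_swapEquiv_mem_zygmundBasis hR
    have hSS : Neg.neg ⁻¹' (Neg.neg ⁻¹' S) = S := by
      ext j
      simp
    rw [hSS] at hR'
    refine hlt.trans_le (le_iSup_of_le _ (le_iSup_of_le hR' (le_iSup_of_le ?_ ?_)))
    · rw [mem_preimage, swapEquiv_swapEquiv]
      exact hxR
    · rw [hσ.measure_preimage_equiv,
        hσ.setLIntegral_comp_preimage_emb swapEquiv.measurableEmbedding
          (fun y => ENNReal.ofReal |f y|)]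
  refine (measure_mono hsub).trans ?_
  rw [hσ.measure_preimage_equiv]
  refine (h _ hfσ α hα).trans_eq ?_
  rw [hσ.lintegral_comp_emb swapEquiv.measurableEmbedding
    (fun y => ENNReal.ofReal (φ (|f y| / α)))]

/-! ### Dyadic cells and sets with prescribed binary digits -/

/-- The dyadic interval `[m 2⁻ᵖ, (m + 1) 2⁻ᵖ)`. -/
def dyadicCell (p m : ℤ) : Set ℝ := {x | ⌊(2 : ℝ) ^ p * x⌋ = m}

/-- The points whose binary digits at the places `l ∈ J` vanish exactly when `l ∈ T`. -/
def digitSet (J : Finset ℤ) (T : Set ℤ) : Set ℝ :=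
  {x | ∀ l ∈ J, (Even ⌊(2 : ℝ) ^ l * x⌋ ↔ l ∈ T)}

theorem dyadicCell_eq_Ico (p m : ℤ) :
    dyadicCell p m = Ico ((m : ℝ) * 2 ^ (-p)) (m * 2 ^ (-p) + 2 ^ (-p)) := by
  ext x
  have hp : (0 : ℝ) < 2 ^ p := by positivity
  rw [dyadicCell, mem_ofPred_eq, Int.floor_eq_iff, mem_Ico, zpow_neg, ← div_eq_mul_inv,
    div_le_iff₀' hp, ← one_div, ← add_div, lt_div_iff₀' hp]

theorem measurableSet_dyadicCell (p m : ℤ) : MeasurableSet (dyadicCell p m) := by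
  rw [dyadicCell_eq_Ico]
  exact measurableSet_Ico

theorem dyadicCell_subset_Icc (p m : ℤ) :
    dyadicCell p m ⊆ Icc ((m : ℝ) * 2 ^ (-p)) (m * 2 ^ (-p) + 2 ^ (-p)) := by
  rw [dyadicCell_eq_Ico]
  exact Ico_subset_Icc_self

theorem volume_dyadicCell (p m : ℤ) : volume (dyadicCell p m) = ENNReal.ofReal (2 ^ (-p)) := by
  rw [dyadicCell_eq_Ico, Real.volume_Ico, add_sub_cancel_left]

theorem measurableSet_digitSet (J : Finset ℤ) (T : Set ℤ) : MeasurableSet (digitSet J T) := by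
  have : digitSet J T = ⋂ l ∈ J, {x | Even ⌊(2 : ℝ) ^ l * x⌋ ↔ l ∈ T} := by
    ext x
    simp [digitSet]
  rw [this]
  refine Finset.measurableSet_biInter J fun l _ => ?_
  have hm : Measurable fun x : ℝ => ⌊(2 : ℝ) ^ l * x⌋ := Int.measurable_floor.comp (by fun_prop)
  exact hm (MeasurableSet.of_discrete (s := {m : ℤ | Even m ↔ l ∈ T}))

theorem floor_eq_floor_succ_ediv (p : ℤ) (x : ℝ) :
    ⌊(2 : ℝ) ^ p * x⌋ = ⌊(2 : ℝ) ^ (p + 1) * x⌋ / 2 := by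
  have h := Int.floor_div_natCast ((2 : ℝ) ^ (p + 1) * x) 2
  rw [Nat.cast_ofNat, Nat.cast_ofNat, zpow_add_one₀ two_ne_zero, mul_right_comm,
    mul_div_cancel_right₀ _ two_ne_zero] at h
  rw [h, zpow_add_one₀ two_ne_zero, mul_right_comm]

/-- A dyadic cell determines all coarser ones, hence all binary digits up to its own level. -/
theorem floor_eq_of_floor_eq {p l : ℤ} (hl : l ≤ p) {x y : ℝ}
    (h : ⌊(2 : ℝ) ^ p * y⌋ = ⌊(2 : ℝ) ^ p * x⌋) : ⌊(2 : ℝ) ^ l * y⌋ = ⌊(2 : ℝ) ^ l * x⌋ := by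
  induction l, hl using Int.leInductionDown with
  | base => exact h
  | pred l _ ih =>
    rw [floor_eq_floor_succ_ediv (l - 1), floor_eq_floor_succ_ediv (l - 1) x, sub_add_cancel, ih]

theorem dyadicCell_eq_union (p m : ℤ) :
    dyadicCell p m = dyadicCell (p + 1) (2 * m) ∪ dyadicCell (p + 1) (2 * m + 1) := by
  ext x
  simp only [dyadicCell, mem_ofPred_eq, mem_union]
  rw [floor_eq_floor_succ_ediv]
  omega

theorem disjoint_dyadicCell {p m m' : ℤ} (h : m ≠ m') :
    Disjoint (dyadicCell p m) (dyadicCell p m') :=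
  disjoint_left.2 fun _ h1 h2 => h (h1.symm.trans h2)

-- Each prescribed digit halves the measure. In the induction on the depth `d`, the cell splits into
-- two halves: exactly one survives if the place `p + 1` is prescribed, and both contribute equally
-- if not.
open Classical in
theorem volume_dyadicCell_inter_digitSet_aux (T : Set ℤ) (d : ℕ) :
    ∀ (p m : ℤ) (J : Finset ℤ), (∀ l ∈ J, p < l ∧ l ≤ p + d) →
      volume (dyadicCell p m ∩ digitSet J T) = ENNReal.ofReal (2 ^ (-p - (J.card : ℤ))) := by
  induction d with
  | zero =>
    intro p m J hJ
    obtain rfl : J = ∅ := Finset.eq_empty_of_forall_notMem fun l hl => by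
      have := hJ l hl
      push_cast at this
      omega
    have : digitSet ∅ T = univ := by
      ext x
      simp [digitSet]
    rw [this, inter_univ, volume_dyadicCell]
    simp
  | succ d ih =>
    intro p m J hJ
    have hm (q : ℤ) : MeasurableSet (dyadicCell (p + 1) q ∩ digitSet J T) :=
      (measurableSet_dyadicCell _ _).inter (measurableSet_digitSet _ _)
    rw [dyadicCell_eq_union, union_inter_distrib_right,
      measure_union ((disjoint_dyadicCell (by omega)).mono inter_subset_left inter_subset_left)
        (hm _)]
    by_cases hp : p + 1 ∈ J
    · have hJ' : ∀ l ∈ J.erase (p + 1), p + 1 < l ∧ l ≤ p + 1 + d := by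
        intro l hl
        obtain ⟨h1, h2⟩ := Finset.mem_erase.1 hl
        have := hJ l h2
        push_cast at this
        omega
      have hcell (q : ℤ) : dyadicCell (p + 1) q ∩ digitSet J T =
          if (Even q ↔ p + 1 ∈ T) then dyadicCell (p + 1) q ∩ digitSet (J.erase (p + 1)) T
          else ∅ := by
        rw [← Finset.insert_erase hp]
        split_ifs with hq
        · ext x
          simp only [mem_inter_iff, digitSet, Finset.mem_insert, mem_ofPred_eq, forall_eq_or_imp]
          refine and_congr_right fun hx => ?_
          rw [dyadicCell, mem_ofPred_eq] at hx
          rw [hx, Finset.erase_insert (Finset.notMem_erase _ _)]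
          exact and_iff_right hq
        · refine eq_empty_of_forall_notMem fun x hx => hq ?_
          have h1 := hx.2 (p + 1) (Finset.mem_insert_self _ _)
          have h2 : ⌊(2 : ℝ) ^ (p + 1) * x⌋ = q := hx.1
          rwa [h2] at h1
      have hcard : ((J.erase (p + 1)).card : ℤ) = J.card - 1 := by
        rw [Finset.card_erase_of_mem hp, Nat.cast_sub (Finset.card_pos.2 ⟨_, hp⟩), Nat.cast_one]
      have hexp : -(p + 1) - ((J.erase (p + 1)).card : ℤ) = -p - (J.card : ℤ) := by omega
      rw [hcell, hcell]
      by_cases hT : p + 1 ∈ T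
      · simp only [hT, iff_true, even_two_mul, if_true, Int.not_even_two_mul_add_one, if_false,
          measure_empty, add_zero]
        rw [ih _ _ _ hJ', hexp]
      · simp only [hT, iff_false, even_two_mul, not_true, if_false, Int.not_even_two_mul_add_one,
          if_true, measure_empty, zero_add]
        rw [ih _ _ _ hJ', hexp]
    · have hJ' : ∀ l ∈ J, p + 1 < l ∧ l ≤ p + 1 + d := by
        intro l hl
        have := hJ l hl
        have h3 : l ≠ p + 1 := fun h => hp (h ▸ hl)
        push_cast at this
        omega
      rw [ih _ _ _ hJ', ih _ _ _ hJ', ← ENNReal.ofReal_add (by positivity) (by positivity)]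
      congr 1
      rw [show -p - (J.card : ℤ) = (-(p + 1) - (J.card : ℤ)) + 1 by ring,
        zpow_add_one₀ two_ne_zero, mul_two]

theorem volume_dyadicCell_inter_digitSet {p : ℤ} (m : ℤ) {J : Finset ℤ} (T : Set ℤ)
    (hJ : ∀ l ∈ J, p < l) :
    volume (dyadicCell p m ∩ digitSet J T) = ENNReal.ofReal (2 ^ (-p - (J.card : ℤ))) := by
  obtain ⟨M, hM⟩ := J.bddAbove
  refine volume_dyadicCell_inter_digitSet_aux T (M - p).toNat p m J fun l hl => ⟨hJ l hl, ?_⟩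
  have := hM hl
  have := Int.self_le_toNat (M - p)
  omega

/-! ### Lower bound with two logarithms -/

theorem exists_lacunary_sequence {S : Set ℤ} (hS : ¬ BddAbove S) :
    ∃ j : ℕ → ℤ, (∀ i, j i ∈ S) ∧ (∀ i, 0 < j i) ∧ ∀ i, 2 * j i + 1 ≤ j (i + 1) := by
  have h (x : ℤ) : ∃ y ∈ S, max 0 (2 * x) < y := not_bddAbove_iff.1 hS _
  choose g hgS hg using h
  have hs (i : ℕ) : g^[i + 2] 0 = g (g^[i + 1] 0) := Function.iterate_succ_apply' g (i + 1) 0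
  have h0 (i : ℕ) : g^[i + 1] 0 = g (g^[i] 0) := Function.iterate_succ_apply' g i 0
  refine ⟨fun i => g^[i + 1] 0, fun i => ?_, fun i => ?_, fun i => ?_⟩
  · simp only [h0, hgS]
  · simp only [h0]
    exact (le_max_left _ _).trans_lt (hg _)
  · change 2 * g^[i + 1] 0 + 1 ≤ g^[i + 2] 0
    rw [hs]
    have := (le_max_right _ _).trans_lt (hg (g^[i + 1] 0))
    omega

/-- `Q` has volume `2 ^ (L - 2 * N)` with `N = 2 * n`, while each of the `n ^ 2` disjoint sets `E
(a, b)` has volume `2 ^ (L - N - 2)`, that is `4 ^ n * |Q| / 4`. -/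
theorem exists_lowerBound_two {S : Set ℤ} (hS : ¬ BddAbove S) (n : ℕ) :
    ∃ Q : Set (Fin 3 → ℝ), MeasurableSet Q ∧ volume Q ≠ 0 ∧ volume Q ≠ ∞ ∧
      ENNReal.ofReal (1 / 4 * n ^ 2 * 4 ^ n) * volume Q ≤
        volume {x | ENNReal.ofReal (1 / (2 * 4 ^ n)) <
          maximalOperator (zygmundBasis S) (Q.indicator 1) x} := by
  obtain ⟨j, hjS, hjpos, hjlac⟩ := exists_lacunary_sequence hS
  have hmono : StrictMono j := strictMono_nat_of_lt_succ fun i => by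
    have := hjpos i
    have := hjlac i
    omega
  set N := 2 * n with hN
  set L : ℤ := j N with hL
  set xs : Finset ℕ → Finset ℤ := fun F => F.image j with hxs
  set ys : Finset ℕ → Finset ℤ := fun F => F.image fun i => -j i with hys
  have hxcard (F : Finset ℕ) : (xs F).card = F.card :=
    Finset.card_image_of_injective _ hmono.injective
  have hycard (F : Finset ℕ) : (ys F).card = F.card :=
    Finset.card_image_of_injective _ (neg_injective.comp hmono.injective)
  have hvx {p : ℤ} (m : ℤ) {F : Finset ℕ} (T : Set ℤ) (h : ∀ i ∈ F, p < j i) :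
      volume (dyadicCell p m ∩ digitSet (xs F) T) = ENNReal.ofReal (2 ^ (-p - (F.card : ℤ))) := by
    rw [← hxcard F]
    refine volume_dyadicCell_inter_digitSet m T fun l hl => ?_
    obtain ⟨i, hi, rfl⟩ := Finset.mem_image.1 hl
    exact h i hi
  have hvy {p : ℤ} (m : ℤ) {F : Finset ℕ} (T : Set ℤ) (h : ∀ i ∈ F, p < -j i) :
      volume (dyadicCell p m ∩ digitSet (ys F) T) = ENNReal.ofReal (2 ^ (-p - (F.card : ℤ))) := by
    rw [← hycard F]
    refine volume_dyadicCell_inter_digitSet m T fun l hl => ?_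
    obtain ⟨i, hi, rfl⟩ := Finset.mem_image.1 hl
    exact h i hi
  have hm (p m : ℤ) (J : Finset ℤ) (T : Set ℤ) : MeasurableSet (dyadicCell p m ∩ digitSet J T) :=
    (measurableSet_dyadicCell _ _).inter (measurableSet_digitSet _ _)
  set A : Set ℝ := dyadicCell 0 0 ∩ digitSet (xs (Finset.range N)) univ with hA
  set B : Set ℝ := dyadicCell (-L) 0 ∩ digitSet (ys (Finset.range N)) univ with hB
  set Q := prodThree A B (Ico 0 1) with hQ
  have hLj {i : ℕ} (hi : i < N) : j i + 1 ≤ L := hmono hi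
  have hvQ : volume Q = ENNReal.ofReal (2 ^ (L - 2 * (N : ℤ))) := by
    rw [hQ, volume_prodThree (hm _ _ _ _) (hm _ _ _ _) measurableSet_Ico,
      hvx 0 univ fun i _ => hjpos i, hvy 0 univ fun i hi => ?_, Real.volume_Ico, sub_zero,
      ENNReal.ofReal_one, mul_one, ← ENNReal.ofReal_mul (by positivity),
      ← zpow_add₀ two_ne_zero, Finset.card_range]
    · congr 2
      ring
    · have := hLj (Finset.mem_range.1 hi)
      omega
  -- In `x` the first odd digit is at `j a` and later digits are free; in `y` the last index with an
  -- odd digit is `b` and smaller indices are free. The height compensates for the number of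
  -- constraints, making all volumes equal.
  set E : ℕ × ℕ → Set (Fin 3 → ℝ) := fun q =>
    prodThree (dyadicCell 0 0 ∩ digitSet (xs (Finset.range (q.1 + 1))) {j q.1}ᶜ)
      (dyadicCell (-L) 0 ∩ digitSet (ys (Finset.Ico q.2 N)) {-j q.2}ᶜ)
      (Ico 0 (2 ^ ((q.1 : ℤ) - q.2 - 1))) with hE
  -- Splitting the indices at `n` ensures `b < a`, so the heights are at least 1.
  set I : Finset (ℕ × ℕ) := Finset.Ico n N ×ˢ Finset.range n with hI
  have hmemI {q : ℕ × ℕ} (hq : q ∈ I) : n ≤ q.1 ∧ q.1 < N ∧ q.2 < n := by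
    rw [hI, Finset.mem_product, Finset.mem_Ico, Finset.mem_range] at hq
    exact ⟨hq.1.1, hq.1.2, hq.2⟩
  have hEm (q : ℕ × ℕ) : MeasurableSet (E q) :=
    measurableSet_prodThree (hm _ _ _ _) (hm _ _ _ _) measurableSet_Ico
  have hvE {q : ℕ × ℕ} (hq : q ∈ I) : volume (E q) = ENNReal.ofReal (2 ^ (L - (N : ℤ) - 2)) := by
    obtain ⟨h1, h2, h3⟩ := hmemI hq
    rw [hE, volume_prodThree (hm _ _ _ _) (hm _ _ _ _) measurableSet_Ico,
      hvx 0 _ fun i _ => hjpos i, hvy 0 _ fun i hi => ?_, Real.volume_Ico, sub_zero,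
      ← ENNReal.ofReal_mul (by positivity), ← ENNReal.ofReal_mul (by positivity),
      ← zpow_add₀ two_ne_zero, ← zpow_add₀ two_ne_zero, Finset.card_range, Nat.card_Ico,
      Nat.cast_sub (by omega)]
    · congr 2
      push_cast
      ring
    · have := hLj (Finset.mem_Ico.1 hi).2
      omega
  have hxeven {a i : ℕ} {x : ℝ} (hx : x ∈ digitSet (xs (Finset.range (a + 1))) {j a}ᶜ)
      (hi : i < a) : Even ⌊(2 : ℝ) ^ j i * x⌋ :=
    (hx (j i) (Finset.mem_image_of_mem _ (Finset.mem_range.2 (by omega)))).2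
      fun h => hi.ne (hmono.injective h)
  have hxodd {a : ℕ} {x : ℝ} (hx : x ∈ digitSet (xs (Finset.range (a + 1))) {j a}ᶜ) :
      ¬ Even ⌊(2 : ℝ) ^ j a * x⌋ := fun h =>
    (hx (j a) (Finset.mem_image_of_mem _ (Finset.mem_range.2 (by omega)))).1 h rfl
  have hyeven {b i : ℕ} {y : ℝ} (hy : y ∈ digitSet (ys (Finset.Ico b N)) {-j b}ᶜ)
      (hi : b < i) (hiN : i < N) : Even ⌊(2 : ℝ) ^ (-j i) * y⌋ :=
    (hy (-j i) (Finset.mem_image_of_mem (fun i => -j i) (Finset.mem_Ico.2 ⟨hi.le, hiN⟩))).2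
      fun h => hi.ne' (hmono.injective (neg_injective h))
  have hyodd {b : ℕ} {y : ℝ} (hy : y ∈ digitSet (ys (Finset.Ico b N)) {-j b}ᶜ) (hb : b < N) :
      ¬ Even ⌊(2 : ℝ) ^ (-j b) * y⌋ := fun h =>
    (hy (-j b) (Finset.mem_image_of_mem (fun i => -j i) (Finset.mem_Ico.2 ⟨le_rfl, hb⟩))).1 h rfl
  have hdisj : (↑I : Set (ℕ × ℕ)).PairwiseDisjoint E := by
    intro q hq q' hq' hne
    obtain ⟨h1, h2, h3⟩ := hmemI hq
    obtain ⟨h1', h2', h3'⟩ := hmemI hq'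
    refine disjoint_left.2 fun x hx hx' => hne ?_
    refine Prod.ext ?_ ?_
    · rcases lt_trichotomy q.1 q'.1 with h | h | h
      · exact absurd (hxeven hx'.1.1.2 h) (hxodd hx.1.1.2)
      · exact h
      · exact absurd (hxeven hx.1.1.2 h) (hxodd hx'.1.1.2)
    · rcases lt_trichotomy q.2 q'.2 with h | h | h
      · exact absurd (hyeven hx.1.2.2 h (by omega)) (hyodd hx'.1.2.2 (by omega))
      · exact h
      · exact absurd (hyeven hx'.1.2.2 h (by omega)) (hyodd hx.1.2.2 (by omega))
  have h4 : (4 : ℝ) ^ n = 2 ^ (N : ℤ) := by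
    rw [zpow_natCast, hN, pow_mul]
    norm_num
  refine ⟨Q, measurableSet_prodThree (hm _ _ _ _) (hm _ _ _ _) measurableSet_Ico, ?_, ?_, ?_⟩
  · rw [hvQ]
    simp only [ne_eq, ENNReal.ofReal_eq_zero, not_le]
    positivity
  · rw [hvQ]
    exact ENNReal.ofReal_ne_top
  · calc _ = ∑ q ∈ I, volume (E q) := by
          rw [hvQ, Finset.sum_congr rfl fun q hq => hvE hq, Finset.sum_const, hI,
            Finset.card_product, Nat.card_Ico, Finset.card_range, nsmul_eq_mul,
            ← ENNReal.ofReal_mul (by positivity), ← ENNReal.ofReal_natCast,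
            ← ENNReal.ofReal_mul (by positivity), h4, show N - n = n by omega]
          congr 1
          rw [show L - (N : ℤ) - 2 = (L - 2 * (N : ℤ)) + N + (-2) by ring,
            zpow_add₀ two_ne_zero, zpow_add₀ two_ne_zero]
          push_cast
          norm_num
          ring
      _ = volume (⋃ q ∈ I, E q) := (measure_biUnion_finset hdisj fun q _ => hEm q).symm
      _ ≤ _ := by
          refine measure_mono (iUnion₂_subset fun q hq x hx => ?_)
          obtain ⟨h1, h2, h3⟩ := hmemI hq
          obtain ⟨a, b⟩ := q
          obtain ⟨⟨⟨hx0, hxd⟩, ⟨hy0, hyd⟩⟩, hz⟩ := hx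
          simp only at h1 h2 h3 hx0 hxd hy0 hyd hz
          -- The box has sides `2 ^ (-p)` and `2 ^ r`, whose ratio is `2 ^ j a`.
          set p : ℤ := j a - j b - 1 with hp
          set r : ℤ := j b + 1 with hr
          -- Lacunarity is used here: from `j a ≥ 2 * j (a - 1) + 1` and `j b ≤ j (a - 1)` follows
          -- `p ≥ j (a - 1)`, so the `x`-cell fixes every digit of index below `a`.
          have hpj {i : ℕ} (hi : i < a) : j i ≤ p := by
            obtain ⟨a', rfl⟩ : ∃ a', a = a' + 1 := ⟨a - 1, by omega⟩
            have h5 : j i ≤ j a' := hmono.monotone (by omega)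
            have h6 : j b ≤ j a' := hmono.monotone (by omega)
            have h7 := hjlac a'
            omega
          have hp0 : 0 ≤ p := (hjpos b).le.trans (hpj (by omega))
          have hbN : b < N := by omega
          have hside : (2 : ℝ) ^ j a * 2 ^ (-p) = 2 ^ (-(-r)) := by
            rw [← zpow_add₀ two_ne_zero]
            congr 1
            omega
          refine lt_maximalOperator_indicator (hjS a) (s := 2 ^ (-p)) (t := 2 ^ ((a : ℤ) - b - 1))
            (a₀ := ⌊(2 : ℝ) ^ p * x 0⌋ * 2 ^ (-p)) (a₁ := ⌊(2 : ℝ) ^ (-r) * x 1⌋ * 2 ^ (-(-r)))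
            (a₂ := 0) (by positivity) (by positivity) (hm _ _ _ _) (hm _ _ _ _) measurableSet_Ico
            (I := dyadicCell p ⌊(2 : ℝ) ^ p * x 0⌋) (J := dyadicCell (-r) ⌊(2 : ℝ) ^ (-r) * x 1⌋)
            (dyadicCell_subset_Icc p ⌊(2 : ℝ) ^ p * x 0⌋)
            (by
              rw [hside]
              exact dyadicCell_subset_Icc (-r) ⌊(2 : ℝ) ^ (-r) * x 1⌋)
            (K := Ico 0 (2 ^ ((a : ℤ) - b - 1))) (by simpa using Ico_subset_Icc_self)
            ⟨⟨rfl, rfl⟩, hz⟩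
            (I' := dyadicCell p ⌊(2 : ℝ) ^ p * x 0⌋ ∩ digitSet (xs (Finset.Ico a N)) univ)
            (J' := dyadicCell (-r) ⌊(2 : ℝ) ^ (-r) * x 1⌋ ∩
              digitSet (ys (Finset.range (b + 1))) univ)
            (K' := Ico 0 1) (fun y hy => ⟨hy.1, ?_, fun l hl => ?_⟩)
            (fun y hy => ⟨hy.1, ?_, fun l hl => ?_⟩) ?_ (hm _ _ _ _) (hm _ _ _ _)
            measurableSet_Ico ?_
          · exact (floor_eq_of_floor_eq hp0 hy.1).trans hx0
          · obtain ⟨i, hi, rfl⟩ := Finset.mem_image.1 hl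
            rcases lt_or_ge i a with hia | hia
            · rw [floor_eq_of_floor_eq (hpj hia) hy.1]
              exact iff_of_true (hxeven hxd hia) trivial
            · exact hy.2 _ (Finset.mem_image_of_mem _
                (Finset.mem_Ico.2 ⟨hia, Finset.mem_range.1 hi⟩))
          · have h5 := hLj hbN
            exact (floor_eq_of_floor_eq (by omega) hy.1).trans hy0
          · obtain ⟨i, hi, rfl⟩ := Finset.mem_image.1 hl
            rcases lt_or_ge b i with hib | hib
            · have h5 := hmono hib
              rw [floor_eq_of_floor_eq (by omega) hy.1]
              exact iff_of_true (hyeven hyd hib (Finset.mem_range.1 hi)) trivial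
            · exact hy.2 _ (Finset.mem_image_of_mem (fun i => -j i)
                (Finset.mem_range.2 (by omega)))
          · refine subset_inter (Ico_subset_Ico_right ?_) subset_rfl
            exact one_le_zpow₀ one_le_two (by omega)
          · rw [hvx _ univ fun i hi => ?_, hvy _ univ fun i hi => ?_, Real.volume_Ico, sub_zero,
              ENNReal.ofReal_one, mul_one, ← ENNReal.ofReal_mul (by positivity),
              ← ENNReal.ofReal_mul (by positivity), hside, h4]
            · refine (ENNReal.ofReal_lt_ofReal_iff (by positivity)).2 ?_
              rw [Nat.card_Ico, Finset.card_range, Nat.cast_sub h2.le, one_div, mul_inv, ← zpow_neg,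
                mul_assoc, ← zpow_add₀ two_ne_zero, ← zpow_add₀ two_ne_zero,
                ← zpow_add₀ two_ne_zero, ← zpow_add₀ two_ne_zero]
              -- The box meets `Q` in the proportions `2 ^ (a - N)`, `2 ^ (-(b + 1))` and `2 ^ (b +
              -- 1 - a)` along the axes, whose product is exactly `2 ^ (-N) = 4 ^ (-n)`. The level
              -- `1 / (2 * 4 ^ n)` leaves the strict inequality.
              have hexp : -(N : ℤ) + (-p + - -r + ((a : ℤ) - b - 1)) =
                  -p - ((N : ℤ) - a) + (- -r - ((b + 1 : ℕ) : ℤ)) := by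
                push_cast
                ring
              rw [hexp]
              have : (0 : ℝ) < 2 ^ (-p - ((N : ℤ) - a) + (- -r - ((b + 1 : ℕ) : ℤ))) := by
                positivity
              linarith
            · have h5 : j i ≤ j b := hmono.monotone (by
                have := Finset.mem_range.1 hi
                omega)
              omega
            · have h5 : j a ≤ j i := hmono.monotone (Finset.mem_Ico.1 hi).1
              have h6 := hjpos b
              omega

theorem not_weakTypeEstimate_zygmundBasis_of_infinite {S : Set ℤ} (hS : S.Infinite) {φ : ℝ → ℝ}
    (hφ : IsConvexIncreasing φ)
    (hlim : Filter.Tendsto (fun x => φ x / (x * Real.log (1 + x) ^ 2)) Filter.atTop (nhds 0)) :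
    ¬ WeakTypeEstimate (zygmundBasis S) φ := by
  have key {T : Set ℤ} (hT : ¬ BddAbove T) : ¬ WeakTypeEstimate (zygmundBasis T) φ :=
    not_weakTypeEstimate_of_lowerBound (by norm_num) (fun n _ => exists_lowerBound_two hT n) hφ hlim
  -- An infinite set of integers bounded above is unbounded below, so its negative is unbounded
  -- above.
  by_cases hab : BddAbove S
  · intro h
    refine key (T := Neg.neg ⁻¹' S) (fun hbel => hS ?_) h.zygmundBasis_neg
    obtain ⟨M, hM⟩ := hab
    obtain ⟨m, hm⟩ := hbel
    refine (finite_Icc (-m) M).subset fun i hi => ⟨?_, hM hi⟩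
    have : -i ≤ m := hm (by simpa using hi)
    omega
  · exact key hab

end

theorem theorem1 (S : Set ℤ) (hS : S.Nonempty) :
    (S.Finite →
      WeakTypeEstimate (zygmundBasis S) (fun x => x * (1 + Real.posLog x)) ∧
      ∀ φ : ℝ → ℝ, IsConvexIncreasing φ →
        Filter.Tendsto (fun x => φ x / (x * Real.log (1 + x))) Filter.atTop (nhds 0) →
        ¬ WeakTypeEstimate (zygmundBasis S) φ) ∧
    (S.Infinite →
      WeakTypeEstimate (zygmundBasis S) (fun x => x * (1 + Real.posLog x) ^ 2) ∧
      ∀ φ : ℝ → ℝ, IsConvexIncreasing φ →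
        Filter.Tendsto (fun x => φ x / (x * Real.log (1 + x) ^ 2)) Filter.atTop (nhds 0) →
        ¬ WeakTypeEstimate (zygmundBasis S) φ) := by
  refine ⟨fun hfin => ⟨weakTypeEstimate_zygmundBasis_of_finite hfin, fun φ hφ hlim => ?_⟩,
    fun hinf => ⟨weakTypeEstimate_zygmundBasis_two S, fun φ hφ hlim =>
      not_weakTypeEstimate_zygmundBasis_of_infinite hinf hφ hlim⟩⟩
  exact not_weakTypeEstimate_of_lowerBound (k := 1) (by norm_num)
    (fun n _ => exists_lowerBound_one hS n) hφ (by simpa using hlim)
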